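/- **Setting.** Let $\mathcal A$ be a cosemisimple Hopf $*$-algebra over $\mathbb C$ with coproduct $\Delta(a)=a_{(1)}\otimes a_{(2)}$, counit $\varepsilon$, antipode $S$ and Haar functional $h$ (the left- and right-invariant linear functional with $h(1)=1$). Let $(\Gamma,\mathrm d)$ be a left-covariant first order differential $*$-calculus over $\mathcal A$; put $\omega(a)=S(a_{(1)})\,\mathrm d a_{(2)}$ and $\mathcal R_\Gamma=\{a:\omega(a)=0,\ \varepsilon(a)=0\}$. Its quantum tangent space is $$\mathcal X=\{X\in\mathcal A' : X(1)=0,\ X(a)=0\ \text{for all}\ a\in\mathcal R_\Gamma\},$$ which is assumed to be finite dimensional. The calculus is assumed to be $S^2$-invariant: there is a linear isomorphism $S^2:\Gamma\to\Gamma$ with $S^2(a\rho b)=S^2(a)S^2(\rho)S^2(b)$ and $S^2(\mathrm d a)=\mathrm dS^2(a)$. Write ${}_{\rm inv}M$ for the left-invariant elements of a left-covariant bimodule $M$. Let $\sigma$ be a *braiding* of $\Gamma$: an automorphism of the left-covariant bimodule $\Gamma\otimes_{\mathcal A}\Gamma$ such that $\sigma_{12}\sigma_{23}\sigma_{12}=\sigma_{23}\sigma_{12}\sigma_{23}$;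 $\sigma$ fixes $\omega(a_{(1)})\otimes_{\mathcal A}\omega(a_{(2)})$ for all $a\in\mathcal R_\Gamma$; $\sigma$ commutes with $S^2\otimes_{\mathcal A} S^2$; and either $(\sigma x)^*=\sigma(x^*)$ for all $x$ or $(\sigma x)^*=\sigma^{-1}(x^*)$ for all $x$, where $(\rho\otimes\rho')^*=\rho'^*\otimes\rho^*$. Let $g:\Gamma\otimes_{\mathcal A}\Gamma\to\mathcal A$ be a *$\sigma$-metric*: a non-degenerate homomorphism of left-covariant bimodules such that $g\sigma=g$, $g_{12}\sigma_{23}^{\pm1}\sigma_{12}^{\pm1}=g_{23}$, $g(\rho\otimes\rho')^*=g(\rho'^*\otimes\rho^*)$, and $g(S^2(\rho')\otimes\rho)=g(\rho\otimes\rho')$ for $\rho,\rho'\in{}_{\rm inv}\Gamma$. The *quantum Clifford algebra* $\mathrm{Cl}=\mathrm{Cl}(\Gamma,\sigma,g)$ is the quotient of the tensor algebra of the bimodule $\Gamma$ by the two-sided ideal generated by $\{x-g(x): x\in\ker(\mathrm{id}-\sigma)\}$, with its natural left coaction. A *spinor module* $\mathcal S$ is a left-covariant left ideal of $\mathrm{Cl}$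 that is also stable under right multiplication by $\mathcal A$; assume $\dim{}_{\rm inv}\mathcal S<\infty$. A *metric* on $\mathcal S$ is a non-degenerate hermitian form $\langle\psi,\varphi\rangle=h(\langle\psi,\varphi\rangle_0)$, where $\langle\cdot,\cdot\rangle_0:\mathcal S\otimes\overline{\mathcal S}\to\mathcal A$ is left-covariant and $\langle a\psi,b\varphi\rangle_0=a\langle\psi,\varphi\rangle_0b^*$. Fix a metric on $\mathcal S$. A *left connection* on a bimodule $\mathcal C$ is a linear map $\nabla:\mathcal C\to\Gamma\otimes_{\mathcal A}\mathcal C$ with $\nabla(a\rho)=\mathrm da\otimes_{\mathcal A}\rho+a\nabla(\rho)$. A *linear left connection* on $\mathcal S$ is a left connection $\nabla_{\mathcal S}$ for which there are a left connection $\nabla$ on $\mathrm{Cl}$ and a bimodule homomorphism $\tilde\sigma:\mathrm{Cl}\otimes_{\mathcal A}\Gamma\to\Gamma\otimes_{\mathcal A}\mathrm{Cl}$ with $\tilde\sigma(u\otimes_{\mathcal A}\mathrm da)=\nabla(ua)-\nabla(u)a$ and $$\nabla_{\mathcal S}(u\varphi)=(\mathrm{id}\otimes_{\mathcal A}\triangleright)\bigl(\nabla(u)\otimes_{\mathcal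 A}\varphi+(\tilde\sigma\otimes_{\mathcal A}\mathrm{id})(u\otimes_{\mathcal A}\nabla_{\mathcal S}(\varphi))\bigr)\qquad(u\in\mathrm{Cl},\ \varphi\in\mathcal S,\ a\in\mathcal A),$$ where $\triangleright:\mathrm{Cl}\otimes_{\mathcal A}\mathcal S\to\mathcal S$ is multiplication. Its *Dirac operator* $D:\mathcal S\to\mathcal S$ is $\nabla_{\mathcal S}$ followed by the multiplication $\Gamma\otimes_{\mathcal A}\mathcal S\to\mathcal S$. Its *connection Laplacian* $\nabla^*\nabla_{\mathcal S}:\mathcal S\to\mathcal S$ is the linear operator determined by $$\langle\nabla^*\nabla_{\mathcal S}(\psi),\varphi\rangle=-h\bigl(g(\langle\nabla_{\mathcal S}\psi,\nabla_{\mathcal S}\varphi\rangle_0)\bigr),\qquad \langle\rho\otimes\psi,\rho'\otimes\varphi\rangle_0:=\rho\otimes_{\mathcal A}\langle\psi,\varphi\rangle_0\rho'^*\quad(\rho,\rho'\in\Gamma).$$ A linear map $\partial:\mathcal S\to\mathcal S$ is a *first order left-invariant differential operator* if, for a basis $\eta_1,\dots,\eta_p$ of ${}_{\rm inv}\mathcal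 S$, there are functionals $p_{j,i}\in\mathbb C\varepsilon+\mathcal X$ with $\partial(a\eta_i)=\sum_j a_{(1)}p_{j,i}(a_{(2)})\eta_j$ for all $a\in\mathcal A$ and all $i$. **Proposition.** Assume that $\ker(\mathrm{id}-\sigma)=\ker(\mathrm{id}-\sigma)^2$ in $\Gamma\otimes_{\mathcal A}\Gamma$. Let $\nabla_{\mathcal S}$ be a left-covariant linear left connection on $\mathcal S$, with Dirac operator $D$. Then the connection Laplacian $\nabla^*\nabla_{\mathcal S}$ exists and is unique, and $\nabla^*\nabla_{\mathcal S}-D^2$ is a first order left-invariant differential operator on $\mathcal S$. -/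

import Mathlib

set_option linter.unusedSectionVars false

open scoped TensorProduct
open MulOpposite

noncomputable section

namespace QuantumSpin

universe u v w

/-! ### Tensor products of bimodules over a noncommutative algebra

A bimodule over the complex algebra `A` is a complex vector space `M` with commuting actions of `A`
(from the left, `a • m`) and of `Aᵐᵒᵖ` (from the right, `op a • m`), both extending the action of
the scalars. -/

section Act

variable (A : Type u) [Ring A] [Algebra ℂ A] (M : Type v) [AddCommGroup M] [Module ℂ M]

/-- The left action of `A` on `M` as a bilinear map, `(a, m) ↦ a m`. -/
def lact [Module A M] [IsScalarTower ℂ A M] : A →ₗ[ℂ] M →ₗ[ℂ] M :=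
  (Algebra.lsmul ℂ ℂ M).toLinearMap

/-- The right action of `A` on `M` as a bilinear map, `(a, m) ↦ m a`. -/
def ract [Module Aᵐᵒᵖ M] [IsScalarTower ℂ Aᵐᵒᵖ M] : A →ₗ[ℂ] M →ₗ[ℂ] M :=
  (Algebra.lsmul ℂ ℂ M).toLinearMap ∘ₗ (opLinearEquiv ℂ : A ≃ₗ[ℂ] Aᵐᵒᵖ).toLinearMap

@[simp] theorem lact_apply [Module A M] [IsScalarTower ℂ A M] (a : A) (m : M) :
    lact A M a m = a • m := rfl

@[simp] theorem ract_apply [Module Aᵐᵒᵖ M] [IsScalarTower ℂ Aᵐᵒᵖ M] (a : A) (m : M) :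
    ract A M a m = op a • m := rfl

end Act

section BalDef

variable (A : Type u) [Ring A]
variable (M : Type v) [AddCommGroup M] [Module ℂ M] [Module Aᵐᵒᵖ M]
variable (N : Type w) [AddCommGroup N] [Module ℂ N] [Module A N]

/-- The relations `m a ⊗ n = m ⊗ a n`. -/
def balancedRel : Submodule ℂ (M ⊗[ℂ] N) :=
  Submodule.span ℂ {x | ∃ (m : M) (a : A) (n : N), x = (op a • m) ⊗ₜ[ℂ] n - m ⊗ₜ[ℂ] (a • n)}

/-- The tensor product `M ⊗_A N` of a right and a left `A`-module. -/
def Bal : Type (max v w) := (M ⊗[ℂ] N) ⧸ balancedRel A M N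

instance : AddCommGroup (Bal A M N) :=
  inferInstanceAs (AddCommGroup ((M ⊗[ℂ] N) ⧸ balancedRel A M N))

instance : Module ℂ (Bal A M N) :=
  inferInstanceAs (Module ℂ ((M ⊗[ℂ] N) ⧸ balancedRel A M N))

/-- The canonical bilinear map `(m, n) ↦ m ⊗_A n`. -/
def Bal.mk : M →ₗ[ℂ] N →ₗ[ℂ] Bal A M N :=
  (TensorProduct.mk ℂ M N).compr₂ (balancedRel A M N).mkQ

end BalDef

namespace Bal

section Universal

variable {A : Type*} [Ring A]
variable {M : Type*} [AddCommGroup M] [Module ℂ M] [Module Aᵐᵒᵖ M]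
variable {N : Type*} [AddCommGroup N] [Module ℂ N] [Module A N]
variable {P : Type*} [AddCommGroup P] [Module ℂ P]

theorem mk_balanced (m : M) (a : A) (n : N) :
    mk A M N (op a • m) n = mk A M N m (a • n) :=
  (Submodule.Quotient.eq _).2 (Submodule.subset_span ⟨m, a, n, rfl⟩)

/-- The universal property of `M ⊗_A N`, for maps that are linear or conjugate linear
over the scalars. -/
def lift {s : ℂ →+* ℂ} (f : M →ₛₗ[s] N →ₛₗ[s] P)
    (hf : ∀ (m : M) (a : A) (n : N), f (op a • m) n = f m (a • n)) : Bal A M N →ₛₗ[s] P :=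
  (balancedRel A M N).liftQ (TensorProduct.lift f) <| by
    refine Submodule.span_le.2 ?_
    rintro x ⟨m, a, n, rfl⟩
    simp [hf]

@[simp] theorem lift_mk {s : ℂ →+* ℂ} (f : M →ₛₗ[s] N →ₛₗ[s] P)
    (hf : ∀ (m : M) (a : A) (n : N), f (op a • m) n = f m (a • n)) (m : M) (n : N) :
    lift f hf (mk A M N m n) = f m n := rfl

theorem hom_ext {s : ℂ →+* ℂ} {f g : Bal A M N →ₛₗ[s] P}
    (h : ∀ m n, f (mk A M N m n) = g (mk A M N m n)) : f = g :=
  Submodule.linearMap_qext _ (TensorProduct.ext' h)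

variable {M' : Type*} [AddCommGroup M'] [Module ℂ M'] [Module Aᵐᵒᵖ M']
variable {N' : Type*} [AddCommGroup N'] [Module ℂ N'] [Module A N']

/-- The map `f ⊗_A g` for a right `A`-linear map `f` and a left `A`-linear map `g`. -/
def map (f : M →ₗ[ℂ] M') (hf : ∀ (a : A) (m : M), f (op a • m) = op a • f m)
    (g : N →ₗ[ℂ] N') (hg : ∀ (a : A) (n : N), g (a • n) = a • g n) :
    Bal A M N →ₗ[ℂ] Bal A M' N' :=
  lift ((mk A M' N').compl₁₂ f g) fun m a n => by simp [hf, hg, mk_balanced]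

@[simp] theorem map_mk (f : M →ₗ[ℂ] M') (hf : ∀ (a : A) (m : M), f (op a • m) = op a • f m)
    (g : N →ₗ[ℂ] N') (hg : ∀ (a : A) (n : N), g (a • n) = a • g n) (m : M) (n : N) :
    map f hf g hg (mk A M N m n) = mk A M' N' (f m) (g n) := rfl

end Universal

section Actions

variable {A : Type*} [Ring A] [Algebra ℂ A]
variable {M : Type*} [AddCommGroup M] [Module ℂ M] [Module Aᵐᵒᵖ M]
variable {N : Type*} [AddCommGroup N] [Module ℂ N] [Module A N]

section Left

variable [Module A M] [SMulCommClass A Aᵐᵒᵖ M] [IsScalarTower ℂ A M]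

/-- The left action `a (m ⊗_A n) = (a m) ⊗_A n`. -/
def lmap (a : A) : Bal A M N →ₗ[ℂ] Bal A M N :=
  map (lact A M a) (fun b m => smul_comm a (op b) m) LinearMap.id (fun _ _ => rfl)

instance : SMul A (Bal A M N) := ⟨fun a x => lmap a x⟩

theorem lmap_mk (a : A) (m : M) (n : N) : lmap a (mk A M N m n) = mk A M N (a • m) n := rfl

@[simp] theorem smul_mk (a : A) (m : M) (n : N) : a • mk A M N m n = mk A M N (a • m) n := rfl

instance : Module A (Bal A M N) where
  one_smul x := by
    refine LinearMap.congr_fun (f := lmap 1) (g := LinearMap.id) (hom_ext fun m n => ?_) x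
    simp [lmap_mk]
  mul_smul a b x := by
    refine LinearMap.congr_fun (f := lmap (a * b)) (g := lmap a ∘ₗ lmap b)
      (hom_ext fun m n => ?_) x
    simp [lmap_mk, mul_smul]
  smul_zero a := map_zero (lmap a)
  smul_add a := map_add (lmap a)
  add_smul a b x := by
    refine LinearMap.congr_fun (f := lmap (a + b)) (g := lmap a + lmap b)
      (hom_ext fun m n => ?_) x
    simp [lmap_mk, add_smul]
  zero_smul x := by
    refine LinearMap.congr_fun (f := lmap (0 : A)) (g := 0) (hom_ext fun m n => ?_) x
    simp [lmap_mk]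

instance : IsScalarTower ℂ A (Bal A M N) where
  smul_assoc c a x := by
    refine LinearMap.congr_fun (f := lmap (c • a)) (g := c • lmap a) (hom_ext fun m n => ?_) x
    simp [lmap_mk]

end Left

section Right

variable [Module Aᵐᵒᵖ N] [SMulCommClass A Aᵐᵒᵖ N] [IsScalarTower ℂ Aᵐᵒᵖ N]

/-- The right action `(m ⊗_A n) a = m ⊗_A (n a)`. -/
def rmap (a : Aᵐᵒᵖ) : Bal A M N →ₗ[ℂ] Bal A M N :=
  map LinearMap.id (fun _ _ => rfl) (ract A N (unop a)) (fun b n => (smul_comm b a n).symm)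

instance : SMul Aᵐᵒᵖ (Bal A M N) := ⟨fun a x => rmap a x⟩

theorem rmap_mk (a : Aᵐᵒᵖ) (m : M) (n : N) : rmap a (mk A M N m n) = mk A M N m (a • n) := rfl

@[simp] theorem op_smul_mk (a : Aᵐᵒᵖ) (m : M) (n : N) :
    a • mk A M N m n = mk A M N m (a • n) := rfl

instance : Module Aᵐᵒᵖ (Bal A M N) where
  one_smul x := by
    refine LinearMap.congr_fun (f := rmap 1) (g := LinearMap.id) (hom_ext fun m n => ?_) x
    simp [rmap_mk]
  mul_smul a b x := by
    refine LinearMap.congr_fun (f := rmap (a * b)) (g := rmap a ∘ₗ rmap b)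
      (hom_ext fun m n => ?_) x
    simp only [LinearMap.comp_apply, rmap_mk, mul_smul]
  smul_zero a := map_zero (rmap a)
  smul_add a := map_add (rmap a)
  add_smul a b x := by
    refine LinearMap.congr_fun (f := rmap (a + b)) (g := rmap a + rmap b)
      (hom_ext fun m n => ?_) x
    simp [rmap_mk, add_smul]
  zero_smul x := by
    refine LinearMap.congr_fun (f := rmap (0 : Aᵐᵒᵖ)) (g := 0) (hom_ext fun m n => ?_) x
    simp [rmap_mk]

instance : IsScalarTower ℂ Aᵐᵒᵖ (Bal A M N) where
  smul_assoc c a x := by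
    refine LinearMap.congr_fun (f := rmap (c • a)) (g := c • rmap a) (hom_ext fun m n => ?_) x
    simp [rmap_mk]

end Right

variable [Module A M] [SMulCommClass A Aᵐᵒᵖ M] [IsScalarTower ℂ A M]
  [Module Aᵐᵒᵖ N] [SMulCommClass A Aᵐᵒᵖ N] [IsScalarTower ℂ Aᵐᵒᵖ N]

instance : SMulCommClass A Aᵐᵒᵖ (Bal A M N) where
  smul_comm a b x := by
    refine LinearMap.congr_fun (f := lact A (Bal A M N) a ∘ₗ ract A (Bal A M N) (unop b))
      (g := ract A (Bal A M N) (unop b) ∘ₗ lact A (Bal A M N) a) (hom_ext fun m n => ?_) x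
    simp

end Actions

section Assoc

variable {A : Type*} [Ring A] [Algebra ℂ A]
variable {M : Type*} [AddCommGroup M] [Module ℂ M] [Module Aᵐᵒᵖ M]
variable {N : Type*} [AddCommGroup N] [Module ℂ N] [Module A N] [Module Aᵐᵒᵖ N]
  [SMulCommClass A Aᵐᵒᵖ N] [IsScalarTower ℂ A N] [IsScalarTower ℂ Aᵐᵒᵖ N]
variable {P : Type*} [AddCommGroup P] [Module ℂ P] [Module A P]

theorem mk_comp_balanced (m : M) :
    ∀ (n : N) (a : A) (p : P),
      ((mk A (Bal A M N) P) ∘ₗ (mk A M N m)) (op a • n) p =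
      ((mk A (Bal A M N) P) ∘ₗ (mk A M N m)) n (a • p) := fun n a p => by
  simp only [LinearMap.comp_apply, ← op_smul_mk, mk_balanced]

theorem mk_flip_comp_balanced (p : P) :
    ∀ (m : M) (a : A) (n : N),
      (((mk A M (Bal A N P)).flip ∘ₗ ((mk A N P).flip p)).flip) (op a • m) n =
      (((mk A M (Bal A N P)).flip ∘ₗ ((mk A N P).flip p)).flip) m (a • n) := fun m a n => by
  simp [mk_balanced]

/-- The canonical map `(M ⊗_A N) ⊗_A P → M ⊗_A (N ⊗_A P)`. -/
def assocHom : Bal A (Bal A M N) P →ₗ[ℂ] Bal A M (Bal A N P) :=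
  lift (LinearMap.mk₂ ℂ (fun x p => lift _ (mk_flip_comp_balanced p) x)
    (fun x y p => map_add _ x y) (fun c x p => map_smul _ c x)
    (fun x p q => by
      refine LinearMap.congr_fun (g := lift _ (mk_flip_comp_balanced p) +
        lift _ (mk_flip_comp_balanced q)) (hom_ext fun m n => ?_) x
      simp)
    (fun c x p => by
      refine LinearMap.congr_fun (g := c • lift _ (mk_flip_comp_balanced p))
        (hom_ext fun m n => ?_) x
      simp))
    (fun x a p => by
      refine LinearMap.congr_fun (f := lift _ (mk_flip_comp_balanced p) ∘ₗ ract A (Bal A M N) a)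
        (g := lift _ (mk_flip_comp_balanced (a • p))) (hom_ext fun m n => ?_) x
      simp [mk_balanced])

/-- The canonical map `M ⊗_A (N ⊗_A P) → (M ⊗_A N) ⊗_A P`. -/
def assocInv : Bal A M (Bal A N P) →ₗ[ℂ] Bal A (Bal A M N) P :=
  lift (LinearMap.mk₂ ℂ (fun m y => lift _ (mk_comp_balanced m) y)
    (fun m m' y => by
      refine LinearMap.congr_fun (g := lift _ (mk_comp_balanced m) +
        lift _ (mk_comp_balanced m')) (hom_ext fun n p => ?_) y
      simp)
    (fun c m y => by
      refine LinearMap.congr_fun (g := c • lift _ (mk_comp_balanced m))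
        (hom_ext fun n p => ?_) y
      simp)
    (fun m x y => map_add _ x y) (fun c m y => map_smul _ c y))
    (fun m a y => by
      refine LinearMap.congr_fun (f := lift _ (mk_comp_balanced (op a • m)))
        (g := lift _ (mk_comp_balanced m) ∘ₗ lact A (Bal A N P) a) (hom_ext fun n p => ?_) y
      simp [mk_balanced])

/-- The canonical isomorphism `(M ⊗_A N) ⊗_A P ≃ M ⊗_A (N ⊗_A P)`. -/
def assoc : Bal A (Bal A M N) P ≃ₗ[ℂ] Bal A M (Bal A N P) :=
  LinearEquiv.ofLinearMap assocHom assocInv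
    (hom_ext fun m y => LinearMap.congr_fun
      (f := assocHom ∘ₗ assocInv ∘ₗ mk A M (Bal A N P) m) (g := mk A M (Bal A N P) m)
      (hom_ext fun _ _ => rfl) y)
    (hom_ext fun x p => LinearMap.congr_fun
      (f := assocInv ∘ₗ assocHom ∘ₗ (mk A (Bal A M N) P).flip p) (g := (mk A (Bal A M N) P).flip p)
      (hom_ext fun _ _ => rfl) x)

@[simp] theorem assoc_mk (m : M) (n : N) (p : P) :
    assoc (mk A (Bal A M N) P (mk A M N m n) p) = mk A M (Bal A N P) m (mk A N P n p) := rfl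

@[simp] theorem assoc_symm_mk (m : M) (n : N) (p : P) :
    assoc.symm (mk A M (Bal A N P) m (mk A N P n p)) = mk A (Bal A M N) P (mk A M N m n) p := rfl

end Assoc

end Bal

/-- `f` is a homomorphism of `A`-bimodules. -/
structure IsBimoduleHom (A : Type*) [Ring A] {M N : Type*} [AddCommGroup M] [Module ℂ M]
    [Module A M] [Module Aᵐᵒᵖ M] [AddCommGroup N] [Module ℂ N] [Module A N] [Module Aᵐᵒᵖ N]
    (f : M →ₗ[ℂ] N) : Prop where
  left : ∀ (a : A) (m : M), f (a • m) = a • f m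
  right : ∀ (a : A) (m : M), f (op a • m) = op a • f m

/-! ### Hopf algebras, comodules and left-covariant bimodules -/

section Hopf

/-- A coassociative and counital right coaction, i.e. a corepresentation of `A` on `V`. -/
structure IsCorepresentation (A : Type*) [Ring A] [HopfAlgebra ℂ A] {V : Type*} [AddCommGroup V]
    [Module ℂ V] (ρ : V →ₗ[ℂ] V ⊗[ℂ] A) : Prop where
  coassoc : ∀ v, TensorProduct.assoc ℂ V A A (ρ.rTensor A (ρ v)) =
    (Coalgebra.comul (R := ℂ) (A := A)).lTensor V (ρ v)
  counit : ∀ v, TensorProduct.rid ℂ V ((Coalgebra.counit (R := ℂ) (A := A)).lTensor V (ρ v)) = v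

/-- `W` is an invariant subspace of the corepresentation `ρ`. -/
def IsSubcorepresentation {A : Type*} [Ring A] [HopfAlgebra ℂ A] {V : Type*} [AddCommGroup V]
    [Module ℂ V] (ρ : V →ₗ[ℂ] V ⊗[ℂ] A) (W : Submodule ℂ V) : Prop :=
  ∀ w ∈ W, ρ w ∈ LinearMap.range (W.subtype.rTensor A)

/-- `W` is a simple subcorepresentation of `ρ`. -/
def IsSimpleSubcorepresentation {A : Type*} [Ring A] [HopfAlgebra ℂ A] {V : Type*}
    [AddCommGroup V] [Module ℂ V] (ρ : V →ₗ[ℂ] V ⊗[ℂ] A) (W : Submodule ℂ V) : Prop :=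
  IsSubcorepresentation ρ W ∧ W ≠ ⊥ ∧
    ∀ W' ≤ W, IsSubcorepresentation ρ W' → W' = ⊥ ∨ W' = W

/-- Every corepresentation of `A` is a direct sum of simple corepresentations. -/
def IsCosemisimple (A : Type u) [Ring A] [HopfAlgebra ℂ A] : Prop :=
  ∀ (V : Type u) [AddCommGroup V] [Module ℂ V] (ρ : V →ₗ[ℂ] V ⊗[ℂ] A),
    IsCorepresentation A ρ →
    ∃ (ι : Type u) (W : ι → Submodule ℂ V),
      (∀ i, IsSimpleSubcorepresentation ρ (W i)) ∧ iSupIndep W ∧ iSup W = ⊤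

variable (A : Type u) [Ring A] [HopfAlgebra ℂ A]

/-- The square of the antipode. -/
def antipodeSq : A →ₗ[ℂ] A := HopfAlgebra.antipode ℂ ∘ₗ HopfAlgebra.antipode ℂ

/-- The normalized left- and right-invariant functional on `A`. -/
structure IsHaarFunctional (h : A →ₗ[ℂ] ℂ) : Prop where
  map_one : h 1 = 1
  left_inv : ∀ a, TensorProduct.rid ℂ A (h.lTensor A (Coalgebra.comul a)) = h a • (1 : A)
  right_inv : ∀ a, TensorProduct.lid ℂ A (h.rTensor A (Coalgebra.comul a)) = h a • (1 : A)

variable {A}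

/-- The convolution action `a ↦ a₍₁₎ p(a₍₂₎)` of a functional `p`. -/
def convRight (p : A →ₗ[ℂ] ℂ) : A →ₗ[ℂ] A :=
  (TensorProduct.rid ℂ A).toLinearMap ∘ₗ p.lTensor A ∘ₗ Coalgebra.comul

section Covariant

variable {M : Type*} [AddCommGroup M] [Module ℂ M] [Module A M] [Module Aᵐᵒᵖ M]
  [IsScalarTower ℂ A M] [IsScalarTower ℂ Aᵐᵒᵖ M]

/-- Left multiplication `(a ⊗ b) (c ⊗ m) = a c ⊗ b m` of `A ⊗ A` on `A ⊗ M`. -/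
def lmulTensor : A ⊗[ℂ] A →ₗ[ℂ] A ⊗[ℂ] M →ₗ[ℂ] A ⊗[ℂ] M :=
  TensorProduct.map₂ (LinearMap.mul ℂ A) (lact A M)

/-- Right multiplication `(c ⊗ m) (a ⊗ b) = c a ⊗ m b` of `A ⊗ A` on `A ⊗ M`. -/
def rmulTensor : A ⊗[ℂ] A →ₗ[ℂ] A ⊗[ℂ] M →ₗ[ℂ] A ⊗[ℂ] M :=
  TensorProduct.map₂ (LinearMap.mul ℂ A).flip (ract A M)

variable (A) in
/-- `δ` is a left coaction that makes the bimodule `M` a left-covariant bimodule. -/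
structure IsLeftCovariant (δ : M →ₗ[ℂ] A ⊗[ℂ] M) : Prop where
  coassoc : ∀ m, TensorProduct.assoc ℂ A A M ((Coalgebra.comul (R := ℂ) (A := A)).rTensor M (δ m)) =
    δ.lTensor A (δ m)
  counit : ∀ m, TensorProduct.lid ℂ M ((Coalgebra.counit (R := ℂ) (A := A)).rTensor M (δ m)) = m
  left : ∀ (a : A) (m : M), δ (a • m) = lmulTensor (Coalgebra.comul a) (δ m)
  right : ∀ (a : A) (m : M), δ (op a • m) = rmulTensor (Coalgebra.comul a) (δ m)

end Covariant

/-- The space of left-invariant elements, `δ m = 1 ⊗ m`. -/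
def leftInv {M : Type*} [AddCommGroup M] [Module ℂ M] (δ : M →ₗ[ℂ] A ⊗[ℂ] M) : Submodule ℂ M :=
  LinearMap.ker (δ - TensorProduct.mk ℂ A M 1)

section Transport

variable {M : Type*} [AddCommGroup M] [Module ℂ M] {N : Type*} [AddCommGroup N] [Module ℂ N]

theorem assoc_comul_lTensor (φ : M →ₗ[ℂ] N) (t : A ⊗[ℂ] M) :
    TensorProduct.assoc ℂ A A N
      ((Coalgebra.comul (R := ℂ) (A := A)).rTensor N (φ.lTensor A t)) =
    (φ.lTensor A).lTensor A (TensorProduct.assoc ℂ A A M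
      ((Coalgebra.comul (R := ℂ) (A := A)).rTensor M t)) := by
  induction t with
  | zero => simp
  | add s t hs ht => simp only [map_add, hs, ht]
  | tmul a m =>
    simp only [LinearMap.lTensor_tmul, LinearMap.rTensor_tmul]
    generalize Coalgebra.comul (R := ℂ) a = s
    induction s with
    | zero => simp
    | add s t hs ht => simp only [map_add, TensorProduct.add_tmul, hs, ht]
    | tmul b c => simp

theorem coassoc_of_hom (δM : M →ₗ[ℂ] A ⊗[ℂ] M) (δN : N →ₗ[ℂ] A ⊗[ℂ] N) (φ : M →ₗ[ℂ] N)
    (hφ : ∀ m, δN (φ m) = φ.lTensor A (δM m)) (m : M)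
    (h : TensorProduct.assoc ℂ A A M ((Coalgebra.comul (R := ℂ) (A := A)).rTensor M (δM m)) =
      δM.lTensor A (δM m)) :
    TensorProduct.assoc ℂ A A N
      ((Coalgebra.comul (R := ℂ) (A := A)).rTensor N (δN (φ m))) = δN.lTensor A (δN (φ m)) := by
  have h' : δN ∘ₗ φ = φ.lTensor A ∘ₗ δM := LinearMap.ext hφ
  have e := LinearMap.congr_fun (congrArg (LinearMap.lTensor A) h') (δM m)
  rw [LinearMap.lTensor_comp, LinearMap.lTensor_comp] at e
  rw [hφ, assoc_comul_lTensor, h]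
  exact e.symm

theorem counit_of_hom (δM : M →ₗ[ℂ] A ⊗[ℂ] M) (δN : N →ₗ[ℂ] A ⊗[ℂ] N) (φ : M →ₗ[ℂ] N)
    (hφ : ∀ m, δN (φ m) = φ.lTensor A (δM m)) (m : M) :
    TensorProduct.lid ℂ N ((Coalgebra.counit (R := ℂ) (A := A)).rTensor N (δN (φ m))) =
      φ (TensorProduct.lid ℂ M ((Coalgebra.counit (R := ℂ) (A := A)).rTensor M (δM m))) := by
  rw [hφ]
  generalize δM m = t
  induction t with
  | zero => simp
  | add s t hs ht => simp only [map_add, hs, ht]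
  | tmul a m => simp

end Transport

section Diag

variable {M : Type*} [AddCommGroup M] [Module ℂ M] [Module A M] [Module Aᵐᵒᵖ M]
  [IsScalarTower ℂ A M] [IsScalarTower ℂ Aᵐᵒᵖ M]
variable {N : Type*} [AddCommGroup N] [Module ℂ N] [Module A N] [Module Aᵐᵒᵖ N]
  [IsScalarTower ℂ A N] [IsScalarTower ℂ Aᵐᵒᵖ N]

/-- The bilinear map `(a ⊗ m, b ⊗ n) ↦ a b ⊗ (m ⊗_A n)`. -/
def diagMul : A ⊗[ℂ] M →ₗ[ℂ] A ⊗[ℂ] N →ₗ[ℂ] A ⊗[ℂ] Bal A M N :=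
  TensorProduct.map₂ (LinearMap.mul ℂ A) (Bal.mk A M N)

theorem diagMul_balanced (x : A ⊗[ℂ] M) (t : A ⊗[ℂ] A) (y : A ⊗[ℂ] N) :
    diagMul (rmulTensor t x) y = diagMul x (lmulTensor t y) := by
  induction t with
  | zero => simp
  | add s t hs ht => simp only [map_add, LinearMap.add_apply, hs, ht]
  | tmul a b =>
    induction x with
    | zero => simp
    | add s t hs ht => simp only [map_add, LinearMap.add_apply, hs, ht]
    | tmul c m =>
      induction y with
      | zero => simp
      | add s t hs ht => simp only [map_add, hs, ht]
      | tmul d n => simp [diagMul, lmulTensor, rmulTensor, Bal.mk_balanced, mul_assoc]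

/-- The coaction `m ⊗_A n ↦ m₍₋₁₎ n₍₋₁₎ ⊗ (m₍₀₎ ⊗_A n₍₀₎)` on a tensor product. -/
def Bal.coact {δM : M →ₗ[ℂ] A ⊗[ℂ] M} (hM : IsLeftCovariant A δM)
    {δN : N →ₗ[ℂ] A ⊗[ℂ] N} (hN : IsLeftCovariant A δN) :
    Bal A M N →ₗ[ℂ] A ⊗[ℂ] Bal A M N :=
  Bal.lift (diagMul.compl₁₂ δM δN) fun m a n => by
    simp [hM.right, hN.left, diagMul_balanced]

@[simp] theorem Bal.coact_mk {δM : M →ₗ[ℂ] A ⊗[ℂ] M} (hM : IsLeftCovariant A δM)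
    {δN : N →ₗ[ℂ] A ⊗[ℂ] N} (hN : IsLeftCovariant A δN) (m : M) (n : N) :
    Bal.coact hM hN (Bal.mk A M N m n) = diagMul (δM m) (δN n) := rfl

end Diag

end Hopf

/-! ### First order differential calculi -/

section Calculus

variable {A : Type u} [Ring A] [HopfAlgebra ℂ A]
variable {Γ : Type v} [AddCommGroup Γ] [Module ℂ Γ] [Module A Γ] [IsScalarTower ℂ A Γ]

/-- The map `ω(a) = S(a₍₁₎) d a₍₂₎`. -/
def mcForm (d : A →ₗ[ℂ] Γ) : A →ₗ[ℂ] Γ :=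
  TensorProduct.lift ((lact A Γ).compl₁₂ (HopfAlgebra.antipode ℂ) d) ∘ₗ Coalgebra.comul

/-- The quantum tangent space: the functionals `X` with `X(1) = 0` that vanish on all `a` with
`ω(a) = 0` and `ε(a) = 0`. It is regarded as a subspace of the convolution algebra of all
functionals on `A`. -/
def tangentSpace (d : A →ₗ[ℂ] Γ) : Submodule ℂ (WithConv (A →ₗ[ℂ] ℂ)) where
  carrier := {X | X.ofConv 1 = 0 ∧
    ∀ a : A, mcForm d a = 0 → Coalgebra.counit (R := ℂ) a = 0 → X.ofConv a = 0}
  zero_mem' := by simp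
  add_mem' := by
    rintro X Y ⟨hX, hX'⟩ ⟨hY, hY'⟩
    exact ⟨by simp [hX, hY], fun a h1 h2 => by simp [hX' a h1 h2, hY' a h1 h2]⟩
  smul_mem' := by
    rintro c X ⟨hX, hX'⟩
    exact ⟨by simp [hX], fun a h1 h2 => by simp [hX' a h1 h2]⟩

/-- The functionals of degree at most `m` in the algebra generated by the tangent space: the span
of the products of at most `m` tangent functionals. -/
def degreeLE (d : A →ₗ[ℂ] Γ) (m : ℕ) : Submodule ℂ (WithConv (A →ₗ[ℂ] ℂ)) :=
  (1 ⊔ tangentSpace d) ^ m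

end Calculus

/-- A finite dimensional `S²`-invariant left-covariant first order differential `*`-calculus on the
Hopf `*`-algebra `A`, with bimodule of one-forms `Γ`. The field `sq` is the isomorphism of the
calculus with its twist by the automorphism `S²` of `A`. -/
structure StarCalculus (A : Type u) [Ring A] [StarRing A] [HopfAlgebra ℂ A] (Γ : Type v)
    [AddCommGroup Γ] [Module ℂ Γ] [Module A Γ] [Module Aᵐᵒᵖ Γ] [SMulCommClass A Aᵐᵒᵖ Γ]
    [IsScalarTower ℂ A Γ] [IsScalarTower ℂ Aᵐᵒᵖ Γ] [StarAddMonoid Γ] where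
  d : A →ₗ[ℂ] Γ
  leibniz : ∀ a b, d (a * b) = op b • d a + a • d b
  generates : Submodule.span ℂ {γ | ∃ a b : A, γ = a • d b} = ⊤
  coact : Γ →ₗ[ℂ] A ⊗[ℂ] Γ
  covariant : IsLeftCovariant A coact
  coact_d : ∀ a, coact (d a) = d.lTensor A (Coalgebra.comul a)
  star_smul : ∀ (a : A) (γ : Γ), star (a • γ) = op (star a) • star γ
  star_op_smul : ∀ (a : A) (γ : Γ), star (op a • γ) = star a • star γ
  star_d : ∀ a, star (d a) = d (star a)
  finite : FiniteDimensional ℂ (tangentSpace d)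
  sq : Γ ≃ₗ[ℂ] Γ
  sq_smul : ∀ (a : A) (γ : Γ), sq (a • γ) = antipodeSq A a • sq γ
  sq_op_smul : ∀ (a : A) (γ : Γ), sq (op a • γ) = op (antipodeSq A a) • sq γ
  sq_d : ∀ a, sq (d a) = d (antipodeSq A a)

section Setting

variable {A : Type u} [Ring A] [StarRing A] [HopfAlgebra ℂ A] [StarModule ℂ A]
variable {Γ : Type v} [AddCommGroup Γ] [Module ℂ Γ] [Module A Γ] [Module Aᵐᵒᵖ Γ]
  [SMulCommClass A Aᵐᵒᵖ Γ] [IsScalarTower ℂ A Γ] [IsScalarTower ℂ Aᵐᵒᵖ Γ]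
  [StarAddMonoid Γ] [StarModule ℂ Γ]

namespace StarCalculus

variable (K : StarCalculus A Γ)

/-- The coaction on `Γ ⊗_A Γ`. -/
def coact₂ : Bal A Γ Γ →ₗ[ℂ] A ⊗[ℂ] Bal A Γ Γ := Bal.coact K.covariant K.covariant

/-- The map `S²(ρ ⊗_A ρ') = S²(ρ) ⊗_A S²(ρ')`. -/
def sq₂ : Bal A Γ Γ →ₗ[ℂ] Bal A Γ Γ :=
  Bal.lift ((Bal.mk A Γ Γ).compl₁₂ K.sq.toLinearMap K.sq.toLinearMap) fun m a n => by
    simp [K.sq_smul, K.sq_op_smul, Bal.mk_balanced]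

/-- The involution `(ρ ⊗_A ρ')^* = ρ'^* ⊗_A ρ^*`. -/
def star₂ : Bal A Γ Γ →ₛₗ[starRingEnd ℂ] Bal A Γ Γ :=
  Bal.lift (LinearMap.mk₂'ₛₗ (starRingEnd ℂ) (starRingEnd ℂ)
    (fun m n => Bal.mk A Γ Γ (star n) (star m))
    (fun m m' n => by simp) (fun c m n => by simp) (fun m n n' => by simp)
    (fun c m n => by simp)) fun m a n => by
      simp only [LinearMap.mk₂'ₛₗ_apply, K.star_smul, K.star_op_smul, Bal.mk_balanced]

end StarCalculus

/-- `f ⊗ id` on `(Γ ⊗_A Γ) ⊗_A Γ`. -/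
def leg₁₂ (f : Bal A Γ Γ →ₗ[ℂ] Bal A Γ Γ) (hf : IsBimoduleHom A f) :
    Bal A (Bal A Γ Γ) Γ →ₗ[ℂ] Bal A (Bal A Γ Γ) Γ :=
  Bal.map f hf.right LinearMap.id (fun _ _ => rfl)

/-- `id ⊗ f` on `(Γ ⊗_A Γ) ⊗_A Γ`, identified with `Γ ⊗_A (Γ ⊗_A Γ)`. -/
def leg₂₃ (f : Bal A Γ Γ →ₗ[ℂ] Bal A Γ Γ) (hf : IsBimoduleHom A f) :
    Bal A (Bal A Γ Γ) Γ →ₗ[ℂ] Bal A (Bal A Γ Γ) Γ :=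
  Bal.assoc.symm.toLinearMap ∘ₗ
    Bal.map LinearMap.id (fun _ _ => rfl) f hf.left ∘ₗ Bal.assoc.toLinearMap

/-- The map `a ⊗ b ↦ ω(a) ⊗_A ω(b)`. -/
def mcForm₂ (K : StarCalculus A Γ) : A ⊗[ℂ] A →ₗ[ℂ] Bal A Γ Γ :=
  TensorProduct.lift ((Bal.mk A Γ Γ).compl₁₂ (mcForm K.d) (mcForm K.d))

/-- A braiding of the calculus. -/
structure Braiding (K : StarCalculus A Γ) where
  σ : Bal A Γ Γ ≃ₗ[ℂ] Bal A Γ Γ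
  hom : IsBimoduleHom A σ.toLinearMap
  covariant : ∀ x, K.coact₂ (σ x) = σ.toLinearMap.lTensor A (K.coact₂ x)
  braid : leg₁₂ σ.toLinearMap hom ∘ₗ leg₂₃ σ.toLinearMap hom ∘ₗ leg₁₂ σ.toLinearMap hom =
    leg₂₃ σ.toLinearMap hom ∘ₗ leg₁₂ σ.toLinearMap hom ∘ₗ leg₂₃ σ.toLinearMap hom
  fixes : ∀ a : A, mcForm K.d a = 0 → Coalgebra.counit (R := ℂ) a = 0 →
    σ (mcForm₂ K (Coalgebra.comul a)) = mcForm₂ K (Coalgebra.comul a)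
  sq_comm : ∀ x, K.sq₂ (σ x) = σ (K.sq₂ x)
  star_comm : (∀ x, K.star₂ (σ x) = σ (K.star₂ x)) ∨ (∀ x, K.star₂ (σ x) = σ.symm (K.star₂ x))

theorem Braiding.hom_symm {K : StarCalculus A Γ} (B : Braiding K) :
    IsBimoduleHom A B.σ.symm.toLinearMap where
  left a x := by
    have h := B.hom.left a (B.σ.symm x)
    simp only [LinearEquiv.coe_coe, LinearEquiv.apply_symm_apply] at h ⊢
    rw [← h, LinearEquiv.symm_apply_apply]
  right a x := by
    have h := B.hom.right a (B.σ.symm x)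
    simp only [LinearEquiv.coe_coe, LinearEquiv.apply_symm_apply] at h ⊢
    rw [← h, LinearEquiv.symm_apply_apply]

/-- `g ⊗ id : (Γ ⊗_A Γ) ⊗_A Γ → Γ`. -/
def contract₁₂ (g : Bal A Γ Γ →ₗ[ℂ] A) (hg : ∀ (a : A) x, g (op a • x) = g x * a) :
    Bal A (Bal A Γ Γ) Γ →ₗ[ℂ] Γ :=
  Bal.lift ((lact A Γ) ∘ₗ g) fun x a γ => by simp [hg, mul_smul]

/-- `id ⊗ g : (Γ ⊗_A Γ) ⊗_A Γ → Γ`. -/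
def contract₂₃ (g : Bal A Γ Γ →ₗ[ℂ] A) (hg : ∀ (a : A) x, g (a • x) = a * g x) :
    Bal A (Bal A Γ Γ) Γ →ₗ[ℂ] Γ :=
  Bal.lift ((ract A Γ).flip.compl₂ g) (fun γ a x => by simp [hg, mul_smul]) ∘ₗ
    Bal.assoc.toLinearMap

/-- A left-covariant `σ`-metric, compatible with the involution and with `S²`. -/
structure SigmaMetric {K : StarCalculus A Γ} (B : Braiding K) where
  g : Bal A Γ Γ →ₗ[ℂ] A
  left : ∀ (a : A) x, g (a • x) = a * g x
  right : ∀ (a : A) x, g (op a • x) = g x * a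
  covariant : ∀ x, Coalgebra.comul (g x) = g.lTensor A (K.coact₂ x)
  nondegenerate_left : ∀ γ, (∀ γ', g (Bal.mk A Γ Γ γ γ') = 0) → γ = 0
  nondegenerate_right : ∀ γ', (∀ γ, g (Bal.mk A Γ Γ γ γ') = 0) → γ' = 0
  symm : ∀ x, g (B.σ x) = g x
  contract : ∀ x, contract₁₂ g right (leg₂₃ _ B.hom (leg₁₂ _ B.hom x)) = contract₂₃ g left x
  contract_inv : ∀ x, contract₁₂ g right (leg₂₃ _ B.hom_symm (leg₁₂ _ B.hom_symm x)) = contract₂₃ g left x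
  star_comm : ∀ γ γ', star (g (Bal.mk A Γ Γ γ γ')) = g (Bal.mk A Γ Γ (star γ') (star γ))
  sq_symm : ∀ γ ∈ leftInv K.coact, ∀ γ' ∈ leftInv K.coact,
    g (Bal.mk A Γ Γ (K.sq γ') γ) = g (Bal.mk A Γ Γ γ γ')

/-! ### The tensor algebra of a bimodule and the quantum Clifford algebra -/

variable (A Γ) in
/-- The relations defining the tensor algebra of the bimodule `Γ` as a quotient of the free
(tensor) algebra of the vector space `A × Γ`. -/
inductive BimoduleTensorRel : TensorAlgebra ℂ (A × Γ) → TensorAlgebra ℂ (A × Γ) → Prop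
  | one : BimoduleTensorRel (TensorAlgebra.ι ℂ (1, 0)) 1
  | mul (a b : A) : BimoduleTensorRel
      (TensorAlgebra.ι ℂ (a, 0) * TensorAlgebra.ι ℂ (b, 0)) (TensorAlgebra.ι ℂ (a * b, 0))
  | smul (a : A) (γ : Γ) : BimoduleTensorRel
      (TensorAlgebra.ι ℂ (a, 0) * TensorAlgebra.ι ℂ (0, γ)) (TensorAlgebra.ι ℂ (0, a • γ))
  | op_smul (a : A) (γ : Γ) : BimoduleTensorRel
      (TensorAlgebra.ι ℂ (0, γ) * TensorAlgebra.ι ℂ (a, 0)) (TensorAlgebra.ι ℂ (0, op a • γ))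

variable (A Γ) in
/-- The tensor algebra `A ⊕ Γ ⊕ (Γ ⊗_A Γ) ⊕ …` of the bimodule `Γ`, given as the universal algebra
that contains images of `A` and `Γ` whose products are those of `A` and the two actions on `Γ`. -/
def BimoduleTensorAlgebra : Type (max u v) := RingQuot (BimoduleTensorRel A Γ)

namespace BimoduleTensorAlgebra

instance : Ring (BimoduleTensorAlgebra A Γ) :=
  inferInstanceAs (Ring (RingQuot (BimoduleTensorRel A Γ)))

instance : Algebra ℂ (BimoduleTensorAlgebra A Γ) :=
  inferInstanceAs (Algebra ℂ (RingQuot (BimoduleTensorRel A Γ)))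

variable (A Γ) in
/-- The quotient map. -/
def proj : TensorAlgebra ℂ (A × Γ) →ₐ[ℂ] BimoduleTensorAlgebra A Γ :=
  RingQuot.mkAlgHom ℂ (BimoduleTensorRel A Γ)

theorem proj_rel {x y : TensorAlgebra ℂ (A × Γ)} (h : BimoduleTensorRel A Γ x y) :
    proj A Γ x = proj A Γ y := RingQuot.mkAlgHom_rel ℂ h

variable (A Γ) in
/-- The degree one component. -/
def ofForm : Γ →ₗ[ℂ] BimoduleTensorAlgebra A Γ :=
  (proj A Γ).toLinearMap ∘ₗ TensorAlgebra.ι ℂ ∘ₗ LinearMap.inr ℂ A Γ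

variable (A Γ) in
/-- The degree zero component. -/
def ofAlg : A →ₐ[ℂ] BimoduleTensorAlgebra A Γ :=
  AlgHom.ofLinearMap ((proj A Γ).toLinearMap ∘ₗ TensorAlgebra.ι ℂ ∘ₗ LinearMap.inl ℂ A Γ)
    ((proj_rel .one).trans (map_one _))
    (fun a b => ((map_mul _ _ _).symm.trans (proj_rel (.mul a b))).symm)

theorem ofForm_smul (a : A) (γ : Γ) : ofForm A Γ (a • γ) = ofAlg A Γ a * ofForm A Γ γ :=
  ((map_mul _ _ _).symm.trans (proj_rel (.smul a γ))).symm

theorem ofForm_op_smul (a : A) (γ : Γ) : ofForm A Γ (op a • γ) = ofForm A Γ γ * ofAlg A Γ a :=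
  ((map_mul _ _ _).symm.trans (proj_rel (.op_smul a γ))).symm

variable (A Γ) in
/-- The degree two component `ρ ⊗_A ρ' ↦ ρ ρ'`. -/
def ofForm₂ : Bal A Γ Γ →ₗ[ℂ] BimoduleTensorAlgebra A Γ :=
  Bal.lift ((LinearMap.mul ℂ _).compl₁₂ (ofForm A Γ) (ofForm A Γ)) fun m a n => by
    simp [ofForm_smul, ofForm_op_smul, mul_assoc]

@[simp] theorem ofForm₂_mk (γ γ' : Γ) :
    ofForm₂ A Γ (Bal.mk A Γ Γ γ γ') = ofForm A Γ γ * ofForm A Γ γ' := rfl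

/-- The universal property of the tensor algebra. -/
def lift {R : Type*} [Ring R] [Algebra ℂ R] (f : A →ₐ[ℂ] R) (φ : Γ →ₗ[ℂ] R)
    (h₁ : ∀ (a : A) (γ : Γ), φ (a • γ) = f a * φ γ)
    (h₂ : ∀ (a : A) (γ : Γ), φ (op a • γ) = φ γ * f a) : BimoduleTensorAlgebra A Γ →ₐ[ℂ] R :=
  RingQuot.liftAlgHom ℂ ⟨TensorAlgebra.lift ℂ (f.toLinearMap.coprod φ), by
    intro x y h
    cases h <;> simp [h₁, h₂]⟩

section lift

variable {R : Type*} [Ring R] [Algebra ℂ R] (f : A →ₐ[ℂ] R) (φ : Γ →ₗ[ℂ] R)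
    (h₁ : ∀ (a : A) (γ : Γ), φ (a • γ) = f a * φ γ)
    (h₂ : ∀ (a : A) (γ : Γ), φ (op a • γ) = φ γ * f a)

@[simp] theorem lift_ofAlg (a : A) : lift f φ h₁ h₂ (ofAlg A Γ a) = f a := by
  refine (RingQuot.liftAlgHom_mkAlgHom_apply ℂ _ _ _).trans ?_
  simp

@[simp] theorem lift_ofForm (γ : Γ) : lift f φ h₁ h₂ (ofForm A Γ γ) = φ γ := by
  refine (RingQuot.liftAlgHom_mkAlgHom_apply ℂ _ _ _).trans ?_
  simp

end lift

theorem algHom_ext {R : Type*} [Ring R] [Algebra ℂ R] {f g : BimoduleTensorAlgebra A Γ →ₐ[ℂ] R}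
    (h₁ : ∀ a, f (ofAlg A Γ a) = g (ofAlg A Γ a))
    (h₂ : ∀ γ, f (ofForm A Γ γ) = g (ofForm A Γ γ)) : f = g := by
  apply RingQuot.ringQuot_ext'
  apply TensorAlgebra.hom_ext
  apply LinearMap.prod_ext
  · exact LinearMap.ext h₁
  · exact LinearMap.ext h₂

end BimoduleTensorAlgebra

section Clifford

variable {K : StarCalculus A Γ} {B : Braiding K} (G : SigmaMetric B)

/-- The relations `ρ₂ = g(ρ₂)` for `ρ₂ ∈ ker (id - σ)`. -/
inductive CliffordRel : BimoduleTensorAlgebra A Γ → BimoduleTensorAlgebra A Γ → Prop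
  | mk (x : Bal A Γ Γ) (hx : x ∈ LinearMap.ker (LinearMap.id - B.σ.toLinearMap)) :
      CliffordRel (BimoduleTensorAlgebra.ofForm₂ A Γ x) (BimoduleTensorAlgebra.ofAlg A Γ (G.g x))

/-- The quantum Clifford algebra: the quotient of the tensor algebra of `Γ` by the two-sided ideal
generated by the elements `ρ₂ - g(ρ₂)` with `ρ₂ ∈ ker (id - σ)`. -/
def Clifford : Type (max u v) := RingQuot (CliffordRel G)

namespace Clifford

instance : Ring (Clifford G) := inferInstanceAs (Ring (RingQuot (CliffordRel G)))

instance : Algebra ℂ (Clifford G) := inferInstanceAs (Algebra ℂ (RingQuot (CliffordRel G)))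

/-- The quotient map. -/
def proj : BimoduleTensorAlgebra A Γ →ₐ[ℂ] Clifford G := RingQuot.mkAlgHom ℂ (CliffordRel G)

/-- The canonical map `A → Cl`. -/
def ofAlg : A →ₐ[ℂ] Clifford G := (proj G).comp (BimoduleTensorAlgebra.ofAlg A Γ)

/-- The canonical map `Γ → Cl`. -/
def ofForm : Γ →ₗ[ℂ] Clifford G := (proj G).toLinearMap ∘ₗ BimoduleTensorAlgebra.ofForm A Γ

theorem ofForm_smul (a : A) (γ : Γ) : ofForm G (a • γ) = ofAlg G a * ofForm G γ := by
  simp [ofForm, ofAlg, BimoduleTensorAlgebra.ofForm_smul]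

theorem ofForm_op_smul (a : A) (γ : Γ) : ofForm G (op a • γ) = ofForm G γ * ofAlg G a := by
  simp [ofForm, ofAlg, BimoduleTensorAlgebra.ofForm_op_smul]

/-- The bimodule structure of `Cl`. -/
instance : Module A (Clifford G) := Module.compHom _ (ofAlg G).toRingHom

instance : Module Aᵐᵒᵖ (Clifford G) := Module.compHom (Clifford G) (ofAlg G).toRingHom.op

theorem smul_def (a : A) (x : Clifford G) : a • x = ofAlg G a * x := rfl

theorem op_smul_def (a : A) (x : Clifford G) : op a • x = x * ofAlg G a := rfl

instance : SMulCommClass A Aᵐᵒᵖ (Clifford G) where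
  smul_comm a b x := (mul_assoc (ofAlg G a) x (ofAlg G (unop b))).symm

instance : IsScalarTower ℂ A (Clifford G) where
  smul_assoc c a x := by simp [smul_def]

instance : IsScalarTower ℂ Aᵐᵒᵖ (Clifford G) where
  smul_assoc c a x := by
    induction a with | _ a => rw [← op_smul, op_smul_def, op_smul_def]; simp

theorem lTensor_lmul (f : A →ₐ[ℂ] Clifford G) {M : Type*} [AddCommGroup M] [Module ℂ M]
    [Module A M] [IsScalarTower ℂ A M] (φ : M →ₗ[ℂ] Clifford G)
    (h : ∀ (a : A) (m : M), φ (a • m) = f a * φ m) (t : A ⊗[ℂ] A) (x : A ⊗[ℂ] M) :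
    φ.lTensor A (lmulTensor t x) =
      Algebra.TensorProduct.map (AlgHom.id ℂ A) f t * φ.lTensor A x := by
  induction t with
  | zero => simp
  | add s t hs ht => simp only [map_add, LinearMap.add_apply, hs, ht, add_mul]
  | tmul a b =>
    induction x with
    | zero => simp
    | add s t hs ht => simp only [map_add, hs, ht, mul_add]
    | tmul c m => simp [lmulTensor, h]

theorem lTensor_rmul (f : A →ₐ[ℂ] Clifford G) {M : Type*} [AddCommGroup M] [Module ℂ M]
    [Module Aᵐᵒᵖ M] [IsScalarTower ℂ Aᵐᵒᵖ M] (φ : M →ₗ[ℂ] Clifford G)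
    (h : ∀ (a : A) (m : M), φ (op a • m) = φ m * f a) (t : A ⊗[ℂ] A) (x : A ⊗[ℂ] M) :
    φ.lTensor A (rmulTensor t x) =
      φ.lTensor A x * Algebra.TensorProduct.map (AlgHom.id ℂ A) f t := by
  induction t with
  | zero => simp
  | add s t hs ht => simp only [map_add, LinearMap.add_apply, hs, ht, mul_add]
  | tmul a b =>
    induction x with
    | zero => simp
    | add s t hs ht => simp only [map_add, hs, ht, add_mul]
    | tmul c m => simp [rmulTensor, h]

/-- The left coaction on the tensor algebra with values in `A ⊗ Cl`. -/
def preCoact : BimoduleTensorAlgebra A Γ →ₐ[ℂ] A ⊗[ℂ] Clifford G :=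
  BimoduleTensorAlgebra.lift
    ((Algebra.TensorProduct.map (AlgHom.id ℂ A) (ofAlg G)).comp (Bialgebra.comulAlgHom ℂ A))
    ((ofForm G).lTensor A ∘ₗ K.coact)
    (fun a γ => by
      simp only [LinearMap.comp_apply, K.covariant.left,
        lTensor_lmul G (ofAlg G) (ofForm G) (ofForm_smul G)]
      rfl)
    (fun a γ => by
      simp only [LinearMap.comp_apply, K.covariant.right,
        lTensor_rmul G (ofAlg G) (ofForm G) (ofForm_op_smul G)]
      rfl)

/-- The product `Γ ⊗_A Γ → Cl`. -/
def ofForm₂ : Bal A Γ Γ →ₗ[ℂ] Clifford G :=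
  (proj G).toLinearMap ∘ₗ BimoduleTensorAlgebra.ofForm₂ A Γ

theorem ofForm₂_eq (x : Bal A Γ Γ) (hx : x ∈ LinearMap.ker (LinearMap.id - B.σ.toLinearMap)) :
    ofForm₂ G x = ofAlg G (G.g x) := RingQuot.mkAlgHom_rel ℂ (CliffordRel.mk x hx)

theorem lTensor_diagMul (x y : A ⊗[ℂ] Γ) :
    (ofForm₂ G).lTensor A (diagMul x y) = (ofForm G).lTensor A x * (ofForm G).lTensor A y := by
  induction x with
  | zero => simp
  | add s t hs ht => simp only [map_add, LinearMap.add_apply, hs, ht, add_mul]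
  | tmul a b =>
    induction y with
    | zero => simp
    | add s t hs ht => simp only [map_add, hs, ht, mul_add]
    | tmul c m => simp [diagMul, ofForm₂, ofForm]

theorem preCoact_ofForm₂ (x : Bal A Γ Γ) :
    preCoact G (BimoduleTensorAlgebra.ofForm₂ A Γ x) = (ofForm₂ G).lTensor A (K.coact₂ x) := by
  refine LinearMap.congr_fun (f := (preCoact G).toLinearMap ∘ₗ BimoduleTensorAlgebra.ofForm₂ A Γ)
    (g := (ofForm₂ G).lTensor A ∘ₗ K.coact₂) (Bal.hom_ext fun m n => ?_) x
  simp [StarCalculus.coact₂, preCoact, lTensor_diagMul]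

theorem lTensor_ofForm₂_eq (y : A ⊗[ℂ] Bal A Γ Γ)
    (hy : (LinearMap.id - B.σ.toLinearMap).lTensor A y = 0) :
    (ofForm₂ G).lTensor A y = (ofAlg G).toLinearMap.lTensor A (G.g.lTensor A y) := by
  obtain ⟨z, rfl⟩ := (Module.Flat.lTensor_exact A (LinearMap.exact_subtype_ker_map
    (LinearMap.id - B.σ.toLinearMap)) y).1 hy
  rw [← LinearMap.comp_apply, ← LinearMap.comp_apply, ← LinearMap.comp_apply,
    ← LinearMap.lTensor_comp, ← LinearMap.lTensor_comp, ← LinearMap.lTensor_comp]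
  congr 2
  ext w
  exact ofForm₂_eq G w w.2

/-- The left coaction on `Cl`: the algebra homomorphism that extends the coproduct of `A` and the
coaction on `Γ`. -/
def coactHom : Clifford G →ₐ[ℂ] A ⊗[ℂ] Clifford G :=
  RingQuot.liftAlgHom ℂ ⟨preCoact G, by
    rintro _ _ ⟨x, hx⟩
    rw [preCoact_ofForm₂, lTensor_ofForm₂_eq, ← G.covariant]
    · simp [preCoact]
      rfl
    · have hx' : B.σ x = x := (sub_eq_zero.1 hx).symm
      rw [LinearMap.lTensor_sub, LinearMap.sub_apply, ← B.covariant, hx']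
      simp⟩

theorem coactHom_proj (x : BimoduleTensorAlgebra A Γ) :
    coactHom G (proj G x) = preCoact G x := RingQuot.liftAlgHom_mkAlgHom_apply ℂ _ _ _

theorem coactHom_ofAlg (a : A) : coactHom G (ofAlg G a) =
    Algebra.TensorProduct.map (AlgHom.id ℂ A) (ofAlg G) (Coalgebra.comul a) := by
  refine (coactHom_proj G _).trans ?_
  simp [preCoact]

theorem coactHom_ofForm (γ : Γ) : coactHom G (ofForm G γ) =
    (ofForm G).lTensor A (K.coact γ) := by
  refine (coactHom_proj G _).trans ?_
  simp [preCoact]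

theorem algHom_ext {R : Type*} [Ring R] [Algebra ℂ R] {f g : Clifford G →ₐ[ℂ] R}
    (h₁ : ∀ a, f (ofAlg G a) = g (ofAlg G a))
    (h₂ : ∀ γ, f (ofForm G γ) = g (ofForm G γ)) : f = g := by
  apply RingQuot.ringQuot_ext'
  exact BimoduleTensorAlgebra.algHom_ext h₁ h₂

/-- The left coaction on `Cl` as a linear map. -/
def coact : Clifford G →ₗ[ℂ] A ⊗[ℂ] Clifford G := (coactHom G).toLinearMap

theorem covariant : IsLeftCovariant A (coact G) where
  coassoc x := by
    have h : ((Algebra.TensorProduct.assoc ℂ ℂ ℂ A A (Clifford G)).toAlgHom.comp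
        (Algebra.TensorProduct.map (Bialgebra.comulAlgHom ℂ A) (AlgHom.id ℂ (Clifford G)))).comp
          (coactHom G) =
        (Algebra.TensorProduct.map (AlgHom.id ℂ A) (coactHom G)).comp (coactHom G) := by
      apply algHom_ext
      · intro a
        exact coassoc_of_hom (Coalgebra.comul (R := ℂ) (A := A)) (coact G) (ofAlg G).toLinearMap
          (fun b => coactHom_ofAlg G b) a (Coalgebra.coassoc_apply a)
      · intro γ
        exact coassoc_of_hom K.coact (coact G) (ofForm G) (coactHom_ofForm G) γ
          (K.covariant.coassoc γ)
    exact DFunLike.congr_fun h x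
  counit x := by
    have h : ((Algebra.TensorProduct.lid ℂ (Clifford G)).toAlgHom.comp
        (Algebra.TensorProduct.map (Bialgebra.counitAlgHom ℂ A) (AlgHom.id ℂ (Clifford G)))).comp
          (coactHom G) = AlgHom.id ℂ _ := by
      apply algHom_ext
      · intro a
        refine (counit_of_hom (Coalgebra.comul (R := ℂ) (A := A)) (coact G) (ofAlg G).toLinearMap
          (fun b => coactHom_ofAlg G b) a).trans (congrArg (ofAlg G) ?_)
        simp
      · intro γ
        exact (counit_of_hom K.coact (coact G) (ofForm G) (coactHom_ofForm G) γ).trans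
          (congrArg (ofForm G) (K.covariant.counit γ))
    exact DFunLike.congr_fun h x
  left a x := by
    have h := lTensor_lmul G (ofAlg G) LinearMap.id (fun _ _ => rfl) (Coalgebra.comul a)
      (coactHom G x)
    simp only [LinearMap.lTensor_id, LinearMap.id_apply] at h
    refine Eq.trans ?_ h.symm
    rw [← coactHom_ofAlg, ← map_mul]
    rfl
  right a x := by
    have h := lTensor_rmul G (ofAlg G) LinearMap.id (fun _ _ => rfl) (Coalgebra.comul a)
      (coactHom G x)
    simp only [LinearMap.lTensor_id, LinearMap.id_apply] at h
    refine Eq.trans ?_ h.symm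
    rw [← coactHom_ofAlg, ← map_mul]
    rfl

end Clifford

/-! ### Spinor modules and metrics -/

/-- A spinor module: a left-covariant left ideal of the quantum Clifford algebra that is also
stable under right multiplication by `A`. -/
structure SpinorModule where
  carrier : Submodule ℂ (Clifford G)
  mul_mem : ∀ (u : Clifford G), ∀ ψ ∈ carrier, u * ψ ∈ carrier
  mul_right_mem : ∀ ψ ∈ carrier, ∀ a : A, ψ * Clifford.ofAlg G a ∈ carrier
  coact_mem : ∀ ψ ∈ carrier, Clifford.coact G ψ ∈ LinearMap.range (carrier.subtype.lTensor A)

namespace SpinorModule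

variable {G} (S : SpinorModule G)

/-- The space of spinors. -/
def Space : Type (max u v) := S.carrier

instance : AddCommGroup S.Space := inferInstanceAs (AddCommGroup S.carrier)

instance : Module ℂ S.Space := inferInstanceAs (Module ℂ S.carrier)

/-- The inclusion into the Clifford algebra. -/
def incl : S.Space →ₗ[ℂ] Clifford G := S.carrier.subtype

theorem incl_injective : Function.Injective S.incl := Subtype.val_injective

/-- The action of the Clifford algebra on spinors. -/
instance : Module (Clifford G) S.Space where
  smul u ψ := ⟨u * S.incl ψ, S.mul_mem u _ ψ.2⟩
  one_smul _ := Subtype.ext (one_mul _)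
  mul_smul _ _ _ := Subtype.ext (mul_assoc _ _ _)
  smul_zero _ := Subtype.ext (mul_zero _)
  smul_add _ _ _ := Subtype.ext (mul_add _ _ _)
  add_smul _ _ _ := Subtype.ext (add_mul _ _ _)
  zero_smul _ := Subtype.ext (zero_mul _)

instance : Module A S.Space where
  smul a ψ := ⟨Clifford.ofAlg G a * S.incl ψ, S.mul_mem _ _ ψ.2⟩
  one_smul ψ := S.incl_injective (one_smul A (S.incl ψ))
  mul_smul a b ψ := S.incl_injective (mul_smul a b (S.incl ψ))
  smul_zero a := S.incl_injective (smul_zero (A := Clifford G) a)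
  smul_add a ψ φ := S.incl_injective (smul_add a (S.incl ψ) (S.incl φ))
  add_smul a b ψ := S.incl_injective (add_smul a b (S.incl ψ))
  zero_smul ψ := S.incl_injective (zero_smul A (S.incl ψ))

instance : Module Aᵐᵒᵖ S.Space where
  smul a ψ := ⟨S.incl ψ * Clifford.ofAlg G (unop a), S.mul_right_mem _ ψ.2 _⟩
  one_smul ψ := S.incl_injective (one_smul Aᵐᵒᵖ (S.incl ψ))
  mul_smul a b ψ := S.incl_injective (mul_smul a b (S.incl ψ))
  smul_zero a := S.incl_injective (smul_zero (A := Clifford G) a)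
  smul_add a ψ φ := S.incl_injective (smul_add a (S.incl ψ) (S.incl φ))
  add_smul a b ψ := S.incl_injective (add_smul a b (S.incl ψ))
  zero_smul ψ := S.incl_injective (zero_smul Aᵐᵒᵖ (S.incl ψ))

@[simp] theorem incl_smul (a : A) (ψ : S.Space) : S.incl (a • ψ) = a • S.incl ψ := rfl

@[simp] theorem incl_op_smul (a : Aᵐᵒᵖ) (ψ : S.Space) : S.incl (a • ψ) = a • S.incl ψ := rfl

@[simp] theorem incl_cl_smul (u : Clifford G) (ψ : S.Space) : S.incl (u • ψ) = u * S.incl ψ := rfl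

instance : SMulCommClass A Aᵐᵒᵖ S.Space where
  smul_comm a b ψ := S.incl_injective (smul_comm a b (S.incl ψ))

instance : IsScalarTower ℂ A S.Space where
  smul_assoc c a ψ := S.incl_injective (smul_assoc c a (S.incl ψ))

instance : IsScalarTower ℂ Aᵐᵒᵖ S.Space where
  smul_assoc c a ψ := S.incl_injective (smul_assoc c a (S.incl ψ))

instance : IsScalarTower ℂ (Clifford G) S.Space where
  smul_assoc c u ψ := S.incl_injective (smul_mul_assoc c u (S.incl ψ))

theorem lTensor_incl_injective : Function.Injective (S.incl.lTensor A) :=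
  Module.Flat.lTensor_preserves_injective_linearMap S.incl S.incl_injective

/-- The coaction on spinors, the restriction of the coaction of the Clifford algebra. -/
def coact : S.Space →ₗ[ℂ] A ⊗[ℂ] S.Space :=
  (LinearEquiv.ofInjective (S.incl.lTensor A) S.lTensor_incl_injective).symm.toLinearMap ∘ₗ
    (Clifford.coact G ∘ₗ S.incl).codRestrict _ fun ψ => S.coact_mem ψ.1 ψ.2

theorem coact_incl (ψ : S.Space) :
    Clifford.coact G (S.incl ψ) = S.incl.lTensor A (S.coact ψ) := by
  have h := congrArg Subtype.val (LinearEquiv.apply_symm_apply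
    (LinearEquiv.ofInjective (S.incl.lTensor A) S.lTensor_incl_injective)
    ((Clifford.coact G ∘ₗ S.incl).codRestrict _ (fun ψ => S.coact_mem ψ.1 ψ.2) ψ))
  exact h.symm

theorem lTensor_incl_lmul (t : A ⊗[ℂ] A) (x : A ⊗[ℂ] S.Space) :
    S.incl.lTensor A (lmulTensor t x) = lmulTensor t (S.incl.lTensor A x) := by
  induction t with
  | zero => simp
  | add s t hs ht => simp only [map_add, LinearMap.add_apply, hs, ht]
  | tmul a b =>
    induction x with
    | zero => simp
    | add s t hs ht => simp only [map_add, hs, ht]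
    | tmul c m => simp [lmulTensor]

theorem lTensor_incl_rmul (t : A ⊗[ℂ] A) (x : A ⊗[ℂ] S.Space) :
    S.incl.lTensor A (rmulTensor t x) = rmulTensor t (S.incl.lTensor A x) := by
  induction t with
  | zero => simp
  | add s t hs ht => simp only [map_add, LinearMap.add_apply, hs, ht]
  | tmul a b =>
    induction x with
    | zero => simp
    | add s t hs ht => simp only [map_add, hs, ht]
    | tmul c m => simp [rmulTensor]

theorem covariant : IsLeftCovariant A S.coact where
  coassoc ψ := by
    have h := (Clifford.covariant G).coassoc (S.incl ψ)
    have hφ : Clifford.coact G ∘ₗ S.incl = S.incl.lTensor A ∘ₗ S.coact :=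
      LinearMap.ext S.coact_incl
    rw [S.coact_incl, assoc_comul_lTensor, ← LinearMap.comp_apply (LinearMap.lTensor A _),
      ← LinearMap.lTensor_comp, hφ, LinearMap.lTensor_comp, LinearMap.comp_apply] at h
    exact Module.Flat.lTensor_preserves_injective_linearMap _ S.lTensor_incl_injective h
  counit ψ := S.incl_injective <|
    (counit_of_hom S.coact (Clifford.coact G) S.incl S.coact_incl ψ).symm.trans
      ((Clifford.covariant G).counit (S.incl ψ))
  left a ψ := S.lTensor_incl_injective <| by
    rw [← coact_incl, incl_smul, (Clifford.covariant G).left, coact_incl, lTensor_incl_lmul]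
  right a ψ := S.lTensor_incl_injective <| by
    rw [← coact_incl, incl_op_smul, (Clifford.covariant G).right, coact_incl, lTensor_incl_rmul]

/-- The action `u ⊗_A ψ ↦ u ψ` of the Clifford algebra. -/
def cliffordAct : Bal A (Clifford G) S.Space →ₗ[ℂ] S.Space :=
  Bal.lift (LinearMap.mk₂ ℂ (fun u ψ => u • ψ) add_smul smul_assoc (fun u => smul_add u)
    (fun c u ψ => S.incl_injective (mul_smul_comm c u (S.incl ψ))))
    fun u a ψ => S.incl_injective (mul_assoc u (Clifford.ofAlg G a) (S.incl ψ))

theorem cliffordAct_smul (a : A) (x : Bal A (Clifford G) S.Space) :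
    S.cliffordAct (a • x) = a • S.cliffordAct x := by
  refine LinearMap.congr_fun (f := S.cliffordAct ∘ₗ lact A _ a) (g := lact A _ a ∘ₗ S.cliffordAct)
    (Bal.hom_ext fun u ψ => ?_) x
  exact S.incl_injective (mul_assoc (Clifford.ofAlg G a) u (S.incl ψ))

/-- Clifford multiplication `γ ⊗_A ψ ↦ γ ψ` by one-forms. -/
def formAct : Bal A Γ S.Space →ₗ[ℂ] S.Space :=
  S.cliffordAct ∘ₗ Bal.map (Clifford.ofForm G) (fun a γ => Clifford.ofForm_op_smul G a γ)
    LinearMap.id (fun _ _ => rfl)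

end SpinorModule

/-- A metric on a spinor module, with respect to the Haar functional `h`. The form `form ψ φ` is the
`A`-valued form `⟨ψ, φ⟩₀`; the metric is `⟨ψ, φ⟩ = h(⟨ψ, φ⟩₀)`. -/
structure SpinorMetric {G : SigmaMetric B} (S : SpinorModule G) (h : A →ₗ[ℂ] ℂ) where
  form : S.Space →ₗ[ℂ] S.Space →ₛₗ[starRingEnd ℂ] A
  smul_left : ∀ (a : A) (ψ φ : S.Space), form (a • ψ) φ = a * form ψ φ
  smul_right : ∀ (a : A) (ψ φ : S.Space), form ψ (a • φ) = form ψ φ * star a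
  covariant : ∀ ψ φ : S.Space, Coalgebra.comul (form ψ φ) =
    TensorProduct.map₂ ((LinearMap.mul ℂ A).compl₂ (starLinearEquiv ℂ (A := A)).toLinearMap) form
      (S.coact ψ) (S.coact φ)
  hermitian : ∀ ψ φ : S.Space, h (form ψ φ) = star (h (form φ ψ))
  nondegenerate : ∀ ψ : S.Space, (∀ φ, h (form ψ φ) = 0) → ψ = 0

namespace SpinorMetric

variable {G : SigmaMetric B} {S : SpinorModule G} {h : A →ₗ[ℂ] ℂ} (m : SpinorMetric S h)

/-- For fixed `γ` and `ψ`, the map `γ' ⊗_A φ ↦ γ ⊗_A ⟨ψ, φ⟩₀ γ'^*`. -/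
def pairAux (γ : Γ) (ψ : S.Space) : Bal A Γ S.Space →ₛₗ[starRingEnd ℂ] Bal A Γ Γ :=
  Bal.lift (LinearMap.mk₂'ₛₗ (starRingEnd ℂ) (starRingEnd ℂ)
    (fun γ' φ => Bal.mk A Γ Γ γ (m.form ψ φ • star γ'))
    (fun x y φ => by simp) (fun c x φ => by simp [smul_algebra_smul_comm])
    (fun x φ φ' => by simp [add_smul]) (fun c x φ => by simp)) fun γ' a φ => by
      simp [K.star_op_smul, m.smul_right, mul_smul]

@[simp] theorem pairAux_mk (γ : Γ) (ψ : S.Space) (γ' : Γ) (φ : S.Space) :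
    m.pairAux γ ψ (Bal.mk A Γ S.Space γ' φ) = Bal.mk A Γ Γ γ (m.form ψ φ • star γ') := rfl

/-- The pairing `⟨γ ⊗_A ψ, γ' ⊗_A φ⟩₀ = γ ⊗_A ⟨ψ, φ⟩₀ γ'^*` with values in `Γ ⊗_A Γ`. -/
def pair : Bal A Γ S.Space →ₗ[ℂ] Bal A Γ S.Space →ₛₗ[starRingEnd ℂ] Bal A Γ Γ :=
  Bal.lift (LinearMap.mk₂ ℂ m.pairAux
    (fun x y ψ => Bal.hom_ext fun γ' φ => by simp)
    (fun c x ψ => Bal.hom_ext fun γ' φ => by simp)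
    (fun x ψ ψ' => Bal.hom_ext fun γ' φ => by simp [add_smul])
    (fun c x ψ => Bal.hom_ext fun γ' φ => by simp)) fun x a ψ => Bal.hom_ext fun γ' φ => by
      simp only [LinearMap.mk₂_apply, pairAux_mk, Bal.mk_balanced, m.smul_left, mul_smul]

end SpinorMetric

end Clifford

/-! ### Connections, the Dirac operator, the connection Laplacian, differential operators -/

section Connections

/-- `∇` is a left connection on `M`. -/
def IsLeftConnection (K : StarCalculus A Γ) {M : Type*} [AddCommGroup M] [Module ℂ M] [Module A M]
    [Module Aᵐᵒᵖ M] [SMulCommClass A Aᵐᵒᵖ M] [IsScalarTower ℂ A M] [IsScalarTower ℂ Aᵐᵒᵖ M]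
    (D : M →ₗ[ℂ] Bal A Γ M) : Prop :=
  ∀ (a : A) (m : M), D (a • m) = Bal.mk A Γ M (K.d a) m + a • D m

variable {K : StarCalculus A Γ} {B : Braiding K} {G : SigmaMetric B} (S : SpinorModule G)

/-- `D` is a linear left connection on the spinor module `S`: it is compatible with Clifford
multiplication through some linear left connection `E` on the bimodule `Cl`, where
`τ : Cl ⊗_A Γ → Γ ⊗_A Cl` is the bimodule homomorphism belonging to `E`. -/
structure IsLinearLeftConnection (D : S.Space →ₗ[ℂ] Bal A Γ S.Space) : Prop where
  connection : IsLeftConnection K D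
  compatible : ∃ (E : Clifford G →ₗ[ℂ] Bal A Γ (Clifford G))
    (τ : Bal A (Clifford G) Γ →ₗ[ℂ] Bal A Γ (Clifford G)) (hτ : IsBimoduleHom A τ),
    IsLeftConnection K E ∧
    (∀ (u : Clifford G) (a : A), τ (Bal.mk A _ _ u (K.d a)) = E (op a • u) - op a • E u) ∧
    ∀ (u : Clifford G) (ψ : S.Space), D (u • ψ) =
      Bal.map LinearMap.id (fun _ _ => rfl) S.cliffordAct S.cliffordAct_smul
        (Bal.assoc (Bal.mk A _ _ (E u) ψ +
          Bal.map τ hτ.right LinearMap.id (fun _ _ => rfl)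
            (Bal.assoc.symm (Bal.mk A _ _ u (D ψ)))))

/-- The connection `D` on spinors intertwines the coactions. -/
def IsLeftCovariantConnection (D : S.Space →ₗ[ℂ] Bal A Γ S.Space) : Prop :=
  ∀ ψ, Bal.coact K.covariant S.covariant (D ψ) = D.lTensor A (S.coact ψ)

/-- The Dirac operator of a connection: the connection followed by Clifford multiplication. -/
def diracOperator (D : S.Space →ₗ[ℂ] Bal A Γ S.Space) : S.Space →ₗ[ℂ] S.Space := S.formAct ∘ₗ D

/-- `L` is the connection Laplacian of `D`:
`⟨L ψ, φ⟩ = - h (g (⟨D ψ, D φ⟩₀))` for all spinors `ψ`, `φ`. -/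
def IsConnectionLaplacian {S : SpinorModule G} {h : A →ₗ[ℂ] ℂ} (m : SpinorMetric S h)
    (D : S.Space →ₗ[ℂ] Bal A Γ S.Space) (L : S.Space →ₗ[ℂ] S.Space) : Prop :=
  ∀ ψ φ, h (m.form (L ψ) φ) = - h (G.g (m.pair (D ψ) (D φ)))

/-- `T` is a left-invariant differential operator of order (at most) `k` on the spinor module:
there are a basis `η` of the left-invariant spinors and functionals `p j i` of degree at most `k` in
the algebra generated by the tangent space with `T (a ηᵢ) = ∑ⱼ a₍₁₎ p j i (a₍₂₎) ηⱼ`. -/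
def IsLeftInvariantDiffOp (k : ℕ) (T : S.Space →ₗ[ℂ] S.Space) : Prop :=
  ∃ (n : ℕ) (η : Module.Basis (Fin n) ℂ (leftInv S.coact))
    (p : Fin n → Fin n → WithConv (A →ₗ[ℂ] ℂ)),
    (∀ j i, p j i ∈ degreeLE K.d k) ∧
    ∀ (a : A) (i : Fin n), T (a • (η i : S.Space)) =
      ∑ j, convRight (p j i).ofConv a • (η j : S.Space)

end Connections

end Setting

end QuantumSpin

end

/-! Write P for the projection m ↦ S(m₍₋₁₎)m₍₀₎ onto left-invariant elements. Every left-covariant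
module is spanned by the elements aη with η left-invariant, and da = a₍₁₎ω(a₍₂₎) with ω(a) = P(da).
On left-invariant arguments g and the spinor form take scalar values, since an element of A with
Δ(a) = 1 ⊗ a is a multiple of 1.

Existence of the Laplacian. The connection has an adjoint T, with ⟨Tx, φ⟩ = h(g(⟨x, ∇φ⟩₀)), and the
Laplacian is -T∇; uniqueness is nondegeneracy of the metric. The adjoint rests on integration by
parts, h(a g(θ ⊗ (db)^*)) = -h(g(da ⊗ θ) b^*) for invariant θ (`haar_g_star_d`). This combines the
Haar identity h(a c₍₁₎)c₍₂₎ = h(a₍₁₎c)S⁻¹(a₍₂₎) with the S²-symmetry of g. Applied to ∇(bζ) = db ⊗ ζ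
+ b∇ζ it gives T(aθ ⊗ η) = -g(da ⊗ θ)η + aξ, where the invariant spinor ξ is the Riesz
representative of a functional on the finite dimensional space of invariant spinors
(`exists_adjoint_smul_mk`).

Comparison with the square of the Dirac operator. On aη the only second order part of -T∇ is g(da₍₁₎
⊗ ω(a₍₂₎))η, and that of the squared Dirac operator is da₍₁₎ ω(a₍₂₎) η. Their difference is
a₍₁₎u(a₍₂₎), with u(a) the failure of the Clifford relation on ω(a₍₁₎) ⊗ ω(a₍₂₎), applied to η. For
a in the ideal R_Γ the braiding fixes this tensor, so the Clifford relation holds there and u(a) = 0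
(`conv_cliffordDefect_mem_firstOrder`). Vanishing on R_Γ says that the coordinate functionals of u
lie in ℂε + X. All remaining terms have the form a₍₁₎v(a₍₂₎) with v invariant-valued and zero on
R_Γ, hence are of first order too. -/

noncomputable section

namespace QuantumSpin

open Coalgebra HopfAlgebra

/-! ### Convolution calculus for comodules -/

section Convolution

variable {A : Type*} [Ring A] [HopfAlgebra ℂ A]
variable {M : Type*} [AddCommGroup M] [Module ℂ M]
variable {P : Type*} [AddCommGroup P] [Module ℂ P] {P' : Type*} [AddCommGroup P'] [Module ℂ P']
variable {Q : Type*} [AddCommGroup Q] [Module ℂ Q] {Q' : Type*} [AddCommGroup Q'] [Module ℂ Q']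
variable {R : Type*} [AddCommGroup R] [Module ℂ R]
variable {U : Type*} [AddCommGroup U] [Module ℂ U] {U' : Type*} [AddCommGroup U'] [Module ℂ U']
variable {W : Type*} [AddCommGroup W] [Module ℂ W] {W' : Type*} [AddCommGroup W'] [Module ℂ W']

/-- The convolution `m ↦ β (f m₍₋₁₎) (k m₍₀₎)` of two maps along a bilinear map `β`. -/
def conv (δ : M →ₗ[ℂ] A ⊗[ℂ] M) (β : P →ₗ[ℂ] Q →ₗ[ℂ] R) (f : A →ₗ[ℂ] P) (k : M →ₗ[ℂ] Q) :
    M →ₗ[ℂ] R :=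
  TensorProduct.lift (β.compl₁₂ f k) ∘ₗ δ

theorem conv_apply (δ : M →ₗ[ℂ] A ⊗[ℂ] M) (β : P →ₗ[ℂ] Q →ₗ[ℂ] R) (f : A →ₗ[ℂ] P)
    (k : M →ₗ[ℂ] Q) (m : M) : conv δ β f k m = TensorProduct.lift (β.compl₁₂ f k) (δ m) := rfl

theorem conv_comul_apply (β : P →ₗ[ℂ] Q →ₗ[ℂ] R) (f : A →ₗ[ℂ] P) (k : A →ₗ[ℂ] Q) {a : A}
    {ι : Type*} (r : Coalgebra.Repr ℂ a ι) :
    conv comul β f k a = ∑ i ∈ r.index, β (f (r.left i)) (k (r.right i)) := by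
  rw [conv_apply, ← r.eq, map_sum]
  rfl

/-- Coassociativity turns the associativity of iterated convolutions into a pointwise identity
between bilinear maps. Allowing different bilinear maps on the two sides lets one lemma cover
products, actions and tensor products. Only coassociativity of δ is assumed, so it applies both to
modules and to A itself. -/
theorem conv_assoc {δ : M →ₗ[ℂ] A ⊗[ℂ] M}
    (hδ : ∀ m, TensorProduct.assoc ℂ A A M ((comul (R := ℂ) (A := A)).rTensor M (δ m)) =
      δ.lTensor A (δ m))
    {β : P →ₗ[ℂ] Q →ₗ[ℂ] R} {γ : U →ₗ[ℂ] W →ₗ[ℂ] P}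
    {f : A →ₗ[ℂ] U} {k : A →ₗ[ℂ] W} {l : M →ₗ[ℂ] Q}
    {β' : P' →ₗ[ℂ] Q' →ₗ[ℂ] R} {γ' : U' →ₗ[ℂ] W' →ₗ[ℂ] Q'}
    {f' : A →ₗ[ℂ] P'} {k' : A →ₗ[ℂ] U'} {l' : M →ₗ[ℂ] W'}
    (h : ∀ x y z, β (γ (f x) (k y)) (l z) = β' (f' x) (γ' (k' y) (l' z))) :
    conv δ β (conv comul γ f k) l = conv δ β' f' (conv δ γ' k' l') := by
  -- Both sides are F evaluated on the two bracketings of the iterated coaction.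
  let F : A ⊗[ℂ] (A ⊗[ℂ] M) →ₗ[ℂ] R :=
    TensorProduct.lift (β'.compl₁₂ f' (TensorProduct.lift (γ'.compl₁₂ k' l')))
  have h1 : ∀ t : A ⊗[ℂ] M, TensorProduct.lift (β.compl₁₂ (conv comul γ f k) l) t =
      F (TensorProduct.assoc ℂ A A M ((comul (R := ℂ) (A := A)).rTensor M t)) := by
    intro t
    induction t with
    | zero => simp
    | add s t hs ht => simp only [map_add, hs, ht]
    | tmul a m =>
      simp only [TensorProduct.lift.tmul, LinearMap.compl₁₂_apply, conv_apply,
        LinearMap.rTensor_tmul]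
      generalize comul (R := ℂ) a = s
      induction s with
      | zero => simp
      | add s t hs ht => simp only [map_add, TensorProduct.add_tmul, LinearMap.add_apply, hs, ht]
      | tmul b c => simpa [F] using h b c m
  have h2 : ∀ t : A ⊗[ℂ] M, TensorProduct.lift (β'.compl₁₂ f' (conv δ γ' k' l')) t =
      F (δ.lTensor A t) := by
    intro t
    induction t with
    | zero => simp
    | add s t hs ht => simp only [map_add, hs, ht]
    | tmul a m => simp [F, conv_apply]
  ext m
  rw [conv_apply, conv_apply, h1, h2, hδ]

theorem conv_comul_assoc
    {β : P →ₗ[ℂ] Q →ₗ[ℂ] R} {γ : U →ₗ[ℂ] W →ₗ[ℂ] P}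
    {f : A →ₗ[ℂ] U} {k : A →ₗ[ℂ] W} {l : A →ₗ[ℂ] Q}
    {β' : P' →ₗ[ℂ] Q' →ₗ[ℂ] R} {γ' : U' →ₗ[ℂ] W' →ₗ[ℂ] Q'}
    {f' : A →ₗ[ℂ] P'} {k' : A →ₗ[ℂ] U'} {l' : A →ₗ[ℂ] W'}
    (h : ∀ x y z, β (γ (f x) (k y)) (l z) = β' (f' x) (γ' (k' y) (l' z))) :
    conv comul β (conv comul γ f k) l = conv comul β' f' (conv comul γ' k' l') :=
  conv_assoc (M := A) (δ := comul) (fun m => Coalgebra.coassoc_apply m) (β := β) (γ := γ) (f := f)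
    (k := k) (l := l) (β' := β') (γ' := γ') (f' := f') (k' := k') (l' := l') h

/-- The unit of the convolution product, `a ↦ ε(a) 1`. -/
def convUnit (A : Type*) [Ring A] [HopfAlgebra ℂ A] : A →ₗ[ℂ] A :=
  Algebra.linearMap ℂ A ∘ₗ counit

theorem convUnit_apply (a : A) : convUnit A a = counit (R := ℂ) a • (1 : A) := by
  simp [convUnit, Algebra.algebraMap_eq_smul_one]

theorem conv_unit_left {δ : M →ₗ[ℂ] A ⊗[ℂ] M}
    (hδ : ∀ m, TensorProduct.lid ℂ M ((counit (R := ℂ) (A := A)).rTensor M (δ m)) = m)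
    {β : A →ₗ[ℂ] Q →ₗ[ℂ] R} {k : M →ₗ[ℂ] Q} {l : M →ₗ[ℂ] R} (h : ∀ m, β 1 (k m) = l m) :
    conv δ β (convUnit A) k = l := by
  have h1 : ∀ t : A ⊗[ℂ] M, TensorProduct.lift (β.compl₁₂ (convUnit A) k) t =
      l (TensorProduct.lid ℂ M ((counit (R := ℂ) (A := A)).rTensor M t)) := by
    intro t
    induction t with
    | zero => simp
    | add s t hs ht => simp only [map_add, hs, ht]
    | tmul a m => simp [convUnit_apply, h]
  ext m
  rw [conv_apply, h1, hδ]

theorem conv_comul_unit_left {β : A →ₗ[ℂ] Q →ₗ[ℂ] R} {k : A →ₗ[ℂ] Q} {l : A →ₗ[ℂ] R}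
    (h : ∀ m, β 1 (k m) = l m) : conv comul β (convUnit A) k = l :=
  conv_unit_left (δ := comul) (fun m => by simp) h

theorem conv_comul_unit_right {β : P →ₗ[ℂ] A →ₗ[ℂ] R} {f : A →ₗ[ℂ] P} {l : A →ₗ[ℂ] R}
    (h : ∀ m, β (f m) 1 = l m) : conv comul β f (convUnit A) = l := by
  ext a
  have e : ∀ t : A ⊗[ℂ] A, TensorProduct.lift (β.compl₁₂ f (convUnit A)) t =
      l (TensorProduct.rid ℂ A ((counit (R := ℂ) (A := A)).lTensor A t)) := by
    intro t
    induction t with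
    | zero => simp
    | add s t hs ht => simp only [map_add, hs, ht]
    | tmul a m => simp [convUnit_apply, h]
  rw [conv_apply, e]
  simp

theorem conv_antipode_left :
    conv comul (LinearMap.mul ℂ A) (antipode ℂ) LinearMap.id = convUnit A := by
  ext a
  rw [conv_comul_apply _ _ _ (Coalgebra.Repr.arbitrary ℂ a), convUnit_apply]
  exact sum_antipode_mul_eq_smul _

theorem conv_antipode_right :
    conv comul (LinearMap.mul ℂ A) LinearMap.id (antipode ℂ) = convUnit A := by
  ext a
  rw [conv_comul_apply _ _ _ (Coalgebra.Repr.arbitrary ℂ a), convUnit_apply]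
  exact sum_mul_antipode_eq_smul _

end Convolution

/-! ### The antipode and the projection onto left-invariant elements -/

section Antipode

variable {A : Type*} [Ring A] [HopfAlgebra ℂ A]
variable {M : Type*} [AddCommGroup M] [Module ℂ M] [Module A M] [IsScalarTower ℂ A M]

/-- The projection `m ↦ S(m₍₋₁₎) m₍₀₎` onto the left-invariant elements. -/
def invProj (δ : M →ₗ[ℂ] A ⊗[ℂ] M) : M →ₗ[ℂ] M :=
  conv δ (lact A M) (antipode ℂ) LinearMap.id

/-- The map `a ↦ S(a₍₂₎) ⊗ S(a₍₁₎)`. -/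
def antipodeFlip (A : Type*) [Ring A] [HopfAlgebra ℂ A] : A →ₗ[ℂ] A ⊗[ℂ] A :=
  conv comul (TensorProduct.mk ℂ A A).flip (antipode ℂ) (antipode ℂ)

/-- The left side is S(m₍₋₂₎)m₍₋₁₎ ⊗ S(m₍₋₃₎)m₍₀₎, and the inner antipode pair collapses to a
counit. For M = A this yields the coproduct of the antipode; for general M it yields the invariance
of the projection. -/
theorem conv_antipodeFlip {δ : M →ₗ[ℂ] A ⊗[ℂ] M}
    (hδ : ∀ m, TensorProduct.assoc ℂ A A M ((comul (R := ℂ) (A := A)).rTensor M (δ m)) =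
      δ.lTensor A (δ m))
    (hδ' : ∀ m, TensorProduct.lid ℂ M ((counit (R := ℂ) (A := A)).rTensor M (δ m)) = m) :
    conv δ lmulTensor (antipodeFlip A) δ = TensorProduct.mk ℂ A M 1 ∘ₗ invProj δ := by
  -- Writing δ itself as a convolution makes coassociativity applicable in the form `conv_assoc`.
  have hδm : δ = conv δ (TensorProduct.mk ℂ A M) LinearMap.id LinearMap.id := by
    ext m
    rw [conv_apply]
    exact (DFunLike.congr_fun (TensorProduct.lift_mk (R := ℂ) (M := A) (N := M)) (δ m)).symm
  have h1 : conv δ ((LinearMap.rTensorHom M).comp (LinearMap.mul ℂ A)) (antipode ℂ) δ =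
      TensorProduct.mk ℂ A M 1 := by
    have hδm' := congrArg (conv δ ((LinearMap.rTensorHom M).comp (LinearMap.mul ℂ A))
      (antipode ℂ)) hδm
    rw [hδm', ← conv_assoc hδ (β := TensorProduct.mk ℂ A M) (γ := LinearMap.mul ℂ A) (f := antipode ℂ)
      (k := LinearMap.id) (l := LinearMap.id), conv_antipode_left, conv_unit_left hδ']
    · simp
    · simp
  rw [antipodeFlip, conv_assoc hδ
    (β' := ((LinearMap.lTensorHom A).comp (lact A M)).compl₁₂ LinearMap.id LinearMap.id)
    (γ' := (LinearMap.rTensorHom M).comp (LinearMap.mul ℂ A))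
    (f' := antipode ℂ) (k' := antipode ℂ) (l' := δ), h1]
  · ext m
    rw [conv_apply, LinearMap.comp_apply, invProj, conv_apply]
    generalize δ m = t
    induction t with
    | zero => simp
    | add s t hs ht => simp only [map_add, hs, ht]
    | tmul a m => simp
  · intro x y z
    generalize δ z = t
    induction t with
    | zero => simp
    | add s t hs ht => simp only [map_add, hs, ht]
    | tmul a m => simp [lmulTensor]

theorem lmulTensor_eq_mul (s t : A ⊗[ℂ] A) : lmulTensor s t = s * t := by
  induction s with
  | zero => simp
  | add s s' hs hs' => simp only [map_add, LinearMap.add_apply, hs, hs', add_mul]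
  | tmul a b =>
    induction t with
    | zero => simp
    | add t t' ht ht' => simp only [map_add, ht, ht', mul_add]
    | tmul c d => simp [lmulTensor]

/-- The map a ↦ S(a₍₂₎) ⊗ S(a₍₁₎) is a left convolution inverse of Δ by `conv_antipodeFlip`, while Δ
∘ S is a right inverse because Δ is multiplicative. The two inverses coincide. -/
theorem comul_antipode :
    (comul (R := ℂ) (A := A)) ∘ₗ antipode ℂ = antipodeFlip A := by
  have h := conv_antipodeFlip (A := A) (M := A) (δ := comul) Coalgebra.coassoc_apply
    (fun m => by simp)
  have h1 : WithConv.toConv (antipodeFlip A) * WithConv.toConv (comul (R := ℂ) (A := A)) = 1 := by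
    ext a
    have h' := LinearMap.congr_fun h a
    rw [conv_comul_apply _ _ _ (Coalgebra.Repr.arbitrary ℂ a)] at h'
    rw [(Coalgebra.Repr.arbitrary ℂ a).convMul_apply]
    refine Eq.trans (Finset.sum_congr rfl fun i _ => ?_) (h'.trans ?_)
    · exact (lmulTensor_eq_mul _ _).symm
    · have e : invProj (A := A) (M := A) comul = convUnit A := conv_antipode_left
      rw [LinearMap.comp_apply, e, convUnit_apply]
      simp [Algebra.algebraMap_eq_smul_one, Algebra.TensorProduct.one_def]
  have h2 := left_inv_eq_right_inv h1 LinearMap.comul_right_inv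
  exact (congrArg WithConv.ofConv h2).symm

theorem invProj_mem {δ : M →ₗ[ℂ] A ⊗[ℂ] M}
    (hδ : ∀ m, TensorProduct.assoc ℂ A A M ((comul (R := ℂ) (A := A)).rTensor M (δ m)) =
      δ.lTensor A (δ m))
    (hδ' : ∀ m, TensorProduct.lid ℂ M ((counit (R := ℂ) (A := A)).rTensor M (δ m)) = m)
    (hl : ∀ (a : A) (m : M), δ (a • m) = lmulTensor (comul a) (δ m)) (m : M) :
    invProj δ m ∈ leftInv δ := by
  have h := LinearMap.congr_fun (conv_antipodeFlip hδ hδ') m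
  rw [leftInv, LinearMap.mem_ker, LinearMap.sub_apply, sub_eq_zero]
  refine Eq.trans ?_ h
  rw [← comul_antipode, invProj, conv_apply, conv_apply]
  generalize δ m = t
  induction t with
  | zero => simp
  | add s t hs ht => simp only [map_add, hs, ht]
  | tmul a m => simp [hl]

/-- m₍₋₂₎S(m₍₋₁₎)m₍₀₎ = m: each element is an A-combination of left-invariant ones. -/
theorem conv_invProj {δ : M →ₗ[ℂ] A ⊗[ℂ] M}
    (hδ : ∀ m, TensorProduct.assoc ℂ A A M ((comul (R := ℂ) (A := A)).rTensor M (δ m)) =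
      δ.lTensor A (δ m))
    (hδ' : ∀ m, TensorProduct.lid ℂ M ((counit (R := ℂ) (A := A)).rTensor M (δ m)) = m) :
    conv δ (lact A M) LinearMap.id (invProj δ) = LinearMap.id := by
  rw [invProj, ← conv_assoc hδ (β := lact A M) (γ := LinearMap.mul ℂ A) (f := LinearMap.id)
    (k := antipode ℂ) (l := LinearMap.id), conv_antipode_right, conv_unit_left hδ']
  · simp
  · simp [mul_smul]

theorem mem_leftInv {N : Type*} [AddCommGroup N] [Module ℂ N] {δ : N →ₗ[ℂ] A ⊗[ℂ] N} {n : N} :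
    n ∈ leftInv δ ↔ δ n = 1 ⊗ₜ[ℂ] n := by
  rw [leftInv, LinearMap.mem_ker, LinearMap.sub_apply, sub_eq_zero]
  rfl

/-- S(a₍₁₎)a₍₂₎m = ε(a)m. Hence applying the projection to an A-combination of invariants replaces
the coefficients by complex numbers. -/
theorem invProj_smul {δ : M →ₗ[ℂ] A ⊗[ℂ] M}
    (hl : ∀ (a : A) (m : M), δ (a • m) = lmulTensor (comul a) (δ m)) (a : A) {m : M}
    (hm : m ∈ leftInv δ) : invProj δ (a • m) = counit (R := ℂ) a • m := by
  have h := LinearMap.congr_fun (conv_antipode_left (A := A)) a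
  rw [conv_comul_apply _ _ _ (Coalgebra.Repr.arbitrary ℂ a), convUnit_apply] at h
  rw [invProj, conv_apply, hl, mem_leftInv.1 hm, ← (Coalgebra.Repr.arbitrary ℂ a).eq]
  have h' := congrArg (· • m) h
  simpa [lmulTensor, Finset.sum_smul, mul_smul] using h'

theorem invProj_eq_self {δ : M →ₗ[ℂ] A ⊗[ℂ] M} {m : M} (hm : m ∈ leftInv δ) :
    invProj δ m = m := by
  rw [invProj, conv_apply, mem_leftInv.1 hm]
  simp

/-- A left-covariant module is generated by its left-invariant elements. -/
theorem span_smul_leftInv {δ : M →ₗ[ℂ] A ⊗[ℂ] M}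
    (hδ : ∀ m, TensorProduct.assoc ℂ A A M ((comul (R := ℂ) (A := A)).rTensor M (δ m)) =
      δ.lTensor A (δ m))
    (hδ' : ∀ m, TensorProduct.lid ℂ M ((counit (R := ℂ) (A := A)).rTensor M (δ m)) = m)
    (hl : ∀ (a : A) (m : M), δ (a • m) = lmulTensor (comul a) (δ m)) :
    Submodule.span ℂ {m : M | ∃ a : A, ∃ n ∈ leftInv δ, m = a • n} = ⊤ := by
  rw [eq_top_iff]
  rintro m -
  rw [← LinearMap.id_apply (R := ℂ) m, ← conv_invProj hδ hδ', conv_apply]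
  generalize δ m = t
  induction t with
  | zero => simp
  | add s t hs ht => rw [map_add]; exact add_mem hs ht
  | tmul a m => exact Submodule.subset_span ⟨a, _, invProj_mem hδ hδ' hl m, rfl⟩

/-- Apply id ⊗ ε to Δ(a) = 1 ⊗ a. This is the source of every statement that a form is constant on
invariant elements. -/
theorem mem_leftInv_comul {a : A} (ha : a ∈ leftInv (comul (R := ℂ) (A := A))) :
    a = counit (R := ℂ) a • (1 : A) := by
  have h := congrArg (TensorProduct.rid ℂ A) (lTensor_counit_comul (R := ℂ) a)
  rw [mem_leftInv.1 ha] at h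
  simpa using h.symm

end Antipode

/-! ### Hopf `*`-algebras and the Haar functional -/

section StarHopf

variable {A : Type*} [Ring A] [StarRing A] [HopfAlgebra ℂ A] [StarModule ℂ A]

/-- The image of a representation of the coproduct under the involution. -/
def starRepr (hstar : ∀ a : A, comul (R := ℂ) (star a) = star (comul (R := ℂ) a)) {a : A}
    {ι : Type*} (r : Coalgebra.Repr ℂ a ι) : Coalgebra.Repr ℂ (star a) ι where
  index := r.index
  left i := star (r.left i)
  right i := star (r.right i)
  eq := by rw [hstar, ← r.eq, star_sum]; rfl

/-- The representation `Δ(S(a)) = S(a₍₂₎) ⊗ S(a₍₁₎)`. -/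
def antipodeRepr {a : A} {ι : Type*} (r : Coalgebra.Repr ℂ a ι) :
    Coalgebra.Repr ℂ (antipode ℂ a) ι where
  index := r.index
  left i := antipode ℂ (r.right i)
  right i := antipode ℂ (r.left i)
  eq := by
    rw [← LinearMap.comp_apply, comul_antipode, antipodeFlip, conv_comul_apply _ _ _ r]
    rfl

/-- Both sides equal the sum of ε(a₍₁₎^*) times the conjugate of ε(a₍₂₎), by the two counit axioms;
this is the usual uniqueness argument for counits. -/
theorem counit_star (hstar : ∀ a : A, comul (R := ℂ) (star a) = star (comul (R := ℂ) a)) (a : A) :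
    counit (R := ℂ) (star a) = star (counit (R := ℂ) a) := by
  have r := Coalgebra.Repr.arbitrary ℂ a
  have h1 := congrArg (TensorProduct.lid ℂ A) (sum_counit_tmul_eq (starRepr hstar r))
  have h2 := congrArg (TensorProduct.rid ℂ A) (sum_tmul_counit_eq r)
  simp only [map_sum, TensorProduct.lid_tmul, TensorProduct.rid_tmul, one_smul, starRepr] at h1 h2
  have h3 := congrArg (fun x => counit (R := ℂ) (star x)) h2
  have h4 := congrArg (fun x => star (counit (R := ℂ) (star x))) h1
  simp only [star_sum, star_smul, map_sum, map_smul, star_star, smul_eq_mul, star_mul'] at h3 h4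
  rw [← h3, ← h4]
  exact Finset.sum_congr rfl fun _ _ => mul_comm _ _

/-- The map `a ↦ S(a^*)^*`, the inverse of the antipode of a Hopf `*`-algebra. -/
def starAntipode (A : Type*) [Ring A] [StarRing A] [HopfAlgebra ℂ A] [StarModule ℂ A] :
    A →ₗ[ℂ] A where
  toFun a := star (antipode ℂ (star a))
  map_add' := by simp
  map_smul' := by simp

theorem starAntipode_apply (a : A) : starAntipode A a = star (antipode ℂ (star a)) := rfl

/-- The involution applied to the antipode axiom for a^* gives S⁻¹(a₍₂₎)a₍₁₎ = ε(a)1, the defining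
identity of S⁻¹. -/
theorem conv_starAntipode
    (hstar : ∀ a : A, comul (R := ℂ) (star a) = star (comul (R := ℂ) a)) :
    conv comul (LinearMap.mul ℂ A).flip LinearMap.id (starAntipode A) = convUnit A := by
  ext a
  have r := Coalgebra.Repr.arbitrary ℂ a
  have h := congrArg star (sum_mul_antipode_eq_smul (starRepr hstar r))
  rw [conv_comul_apply _ _ _ r, convUnit_apply]
  simpa [counit_star hstar, starRepr, starAntipode_apply] using h

/-- Applying the antimultiplicative S to `conv_starAntipode` shows that S composed with this map is
a right convolution inverse of S. The identity is a left inverse of S, so the two agree. -/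
theorem antipode_starAntipode
    (hstar : ∀ a : A, comul (R := ℂ) (star a) = star (comul (R := ℂ) a)) (a : A) :
    antipode ℂ (starAntipode A a) = a := by
  have h1 : WithConv.toConv (antipode ℂ (A := A)) *
      WithConv.toConv (antipode ℂ ∘ₗ starAntipode A) = 1 := by
    ext a
    have r := Coalgebra.Repr.arbitrary ℂ a
    have h := congrArg (antipode ℂ) (LinearMap.congr_fun (conv_starAntipode hstar) a)
    rw [conv_comul_apply _ _ _ r, convUnit_apply] at h
    rw [r.convMul_apply]
    simpa [antipode_mul_antidistrib, Algebra.algebraMap_eq_smul_one] using h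
  have h2 := left_inv_eq_right_inv LinearMap.id_mul_antipode h1
  exact (LinearMap.congr_fun (congrArg WithConv.ofConv h2) a).symm

theorem antipode_star_antipode
    (hstar : ∀ a : A, comul (R := ℂ) (star a) = star (comul (R := ℂ) a)) (a : A) :
    antipode ℂ (star (antipode ℂ a)) = star a := by
  have h := antipode_starAntipode hstar (star a)
  rwa [starAntipode_apply, star_star] at h

/-- The Haar functional intertwines `h(a c₍₁₎) c₍₂₎` with `h(a₍₁₎ c) S⁻¹(a₍₂₎)`. -/
theorem conv_haar (hstar : ∀ a : A, comul (R := ℂ) (star a) = star (comul (R := ℂ) a))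
    {h : A →ₗ[ℂ] ℂ} (hh : IsHaarFunctional A h) (a c : A) :
    conv comul (LinearMap.lsmul ℂ A) (h ∘ₗ LinearMap.mulLeft ℂ a) LinearMap.id c =
      conv comul (LinearMap.lsmul ℂ A) (h ∘ₗ LinearMap.mulRight ℂ c)
        (starAntipode A) a := by
  have r := Coalgebra.Repr.arbitrary ℂ c
  -- β(x, y) = h(x c₍₁₎) y c₍₂₎, so that β(a₍₁₎, a₍₂₎) = h(ac)1 by right invariance of h applied to
  -- ac.
  let β : A →ₗ[ℂ] A →ₗ[ℂ] A := ∑ i ∈ r.index,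
    (LinearMap.lsmul ℂ A).compl₁₂ (h ∘ₗ LinearMap.mulRight ℂ (r.left i))
      (LinearMap.mulRight ℂ (r.right i))
  have hβ : ∀ x y, β x y = ∑ i ∈ r.index, h (x * r.left i) • (y * r.right i) := by
    intro x y
    simp [β]
  have h1 : conv comul β LinearMap.id LinearMap.id =
      LinearMap.toSpanSingleton ℂ A 1 ∘ₗ h ∘ₗ LinearMap.mulRight ℂ c := by
    ext a
    have s := Coalgebra.Repr.arbitrary ℂ a
    have e := hh.right_inv (a * c)
    rw [Bialgebra.comul_mul, ← r.eq, ← s.eq, Finset.sum_mul_sum] at e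
    rw [conv_comul_apply _ _ _ s]
    simpa [hβ] using e
  -- Multiplying β(a₍₁₎, a₍₂₎) on the left by S⁻¹(a₍₃₎) cancels a₍₂₎ and leaves β(a, 1) = h(a
  -- c₍₁₎)c₍₂₎.
  have h2 : conv comul (LinearMap.mul ℂ A).flip (conv comul β LinearMap.id LinearMap.id)
      (starAntipode A) = conv comul β LinearMap.id (convUnit A) := by
    rw [← conv_starAntipode hstar]
    refine conv_comul_assoc fun x y z => ?_
    simp [hβ, mul_assoc]
  rw [conv_comul_unit_right (l := β.flip 1) (fun _ => rfl), h1] at h2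
  have h3 := LinearMap.congr_fun h2 a
  rw [conv_comul_apply _ _ _ (Coalgebra.Repr.arbitrary ℂ a), LinearMap.flip_apply, hβ] at h3
  rw [conv_comul_apply _ _ _ r, conv_comul_apply _ _ _ (Coalgebra.Repr.arbitrary ℂ a)]
  simpa using h3.symm

end StarHopf

/-! ### Left-invariant elements of tensor products over A -/

section Invariants

variable {A : Type*} [Ring A] [HopfAlgebra ℂ A]
variable {M : Type*} [AddCommGroup M] [Module ℂ M] [Module A M] [Module Aᵐᵒᵖ M]
  [SMulCommClass A Aᵐᵒᵖ M] [IsScalarTower ℂ A M] [IsScalarTower ℂ Aᵐᵒᵖ M]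
variable {N : Type*} [AddCommGroup N] [Module ℂ N] [Module A N] [Module Aᵐᵒᵖ N]
  [SMulCommClass A Aᵐᵒᵖ N] [IsScalarTower ℂ A N] [IsScalarTower ℂ Aᵐᵒᵖ N]

theorem Bal.induction_on {p : Bal A M N → Prop} (x : Bal A M N)
    (mk : ∀ m n, p (Bal.mk A M N m n)) (add : ∀ x y, p x → p y → p (x + y)) : p x := by
  obtain ⟨t, rfl⟩ := Submodule.mkQ_surjective (balancedRel A M N) x
  induction t with
  | zero => rw [map_zero]; exact (map_zero (Bal.mk A M N (0 : M))) ▸ mk 0 0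
  | add s t hs ht => rw [map_add]; exact add _ _ hs ht
  | tmul m n => exact mk m n

theorem IsLeftCovariant.span_smul {δ : M →ₗ[ℂ] A ⊗[ℂ] M} (hδ : IsLeftCovariant A δ) :
    Submodule.span ℂ {m : M | ∃ a : A, ∃ n ∈ leftInv δ, m = a • n} = ⊤ :=
  span_smul_leftInv hδ.coassoc hδ.counit hδ.left

theorem Bal.mk_mem_leftInv {δM : M →ₗ[ℂ] A ⊗[ℂ] M} (hM : IsLeftCovariant A δM)
    {δN : N →ₗ[ℂ] A ⊗[ℂ] N} (hN : IsLeftCovariant A δN) {m : M} (hm : m ∈ leftInv δM) {n : N}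
    (hn : n ∈ leftInv δN) : Bal.mk A M N m n ∈ leftInv (Bal.coact hM hN) := by
  rw [mem_leftInv, Bal.coact_mk, mem_leftInv.1 hm, mem_leftInv.1 hn]
  simp [diagMul]

theorem lmulTensor_diagMul (t : A ⊗[ℂ] A) (x : A ⊗[ℂ] M) (y : A ⊗[ℂ] N) :
    diagMul (lmulTensor t x) y = lmulTensor t (diagMul x y) := by
  induction t with
  | zero => simp
  | add s t hs ht => simp only [map_add, LinearMap.add_apply, hs, ht]
  | tmul a b =>
    induction x with
    | zero => simp
    | add s t hs ht => simp only [map_add, LinearMap.add_apply, hs, ht]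
    | tmul c m =>
      induction y with
      | zero => simp
      | add s t hs ht => simp only [map_add, hs, ht]
      | tmul d n => simp [diagMul, lmulTensor, mul_assoc]

theorem Bal.coact_smul {δM : M →ₗ[ℂ] A ⊗[ℂ] M} (hM : IsLeftCovariant A δM)
    {δN : N →ₗ[ℂ] A ⊗[ℂ] N} (hN : IsLeftCovariant A δN) (a : A) (x : Bal A M N) :
    Bal.coact hM hN (a • x) = lmulTensor (comul a) (Bal.coact hM hN x) := by
  refine LinearMap.congr_fun (f := Bal.coact hM hN ∘ₗ lact A _ a)
    (g := lmulTensor (comul a) ∘ₗ Bal.coact hM hN) (Bal.hom_ext fun m n => ?_) x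
  simp [hM.left, lmulTensor_diagMul]

/-- A tensor product of left-covariant bimodules is generated by the products of left-invariant
elements. -/
theorem Bal.span_smul_mk {δM : M →ₗ[ℂ] A ⊗[ℂ] M} (hM : IsLeftCovariant A δM)
    {δN : N →ₗ[ℂ] A ⊗[ℂ] N} (hN : IsLeftCovariant A δN) :
    Submodule.span ℂ {x : Bal A M N | ∃ a : A, ∃ m ∈ leftInv δM, ∃ n ∈ leftInv δN,
      x = a • Bal.mk A M N m n} = ⊤ := by
  rw [eq_top_iff]
  set V := Submodule.span ℂ {x : Bal A M N | ∃ a : A, ∃ m ∈ leftInv δM, ∃ n ∈ leftInv δN,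
      x = a • Bal.mk A M N m n}
  have h1 : ∀ (n : N), n ∈ leftInv δN → ∀ m : M, Bal.mk A M N m n ∈ V := by
    intro n hn m
    have hm : m ∈ Submodule.span ℂ {m : M | ∃ a : A, ∃ n ∈ leftInv δM, m = a • n} := by
      rw [hM.span_smul]; trivial
    induction hm using Submodule.span_induction with
    | mem m hm =>
      obtain ⟨a, m, hm, rfl⟩ := hm
      exact Submodule.subset_span ⟨a, m, hm, n, hn, rfl⟩
    | zero => simp
    | add x y _ _ hx hy => rw [map_add]; exact add_mem hx hy
    | smul c x _ hx => rw [map_smul]; exact V.smul_mem c hx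
  have h2 : ∀ (m : M) (n : N), Bal.mk A M N m n ∈ V := by
    intro m n
    have hn : n ∈ Submodule.span ℂ {m : N | ∃ a : A, ∃ n ∈ leftInv δN, m = a • n} := by
      rw [hN.span_smul]; trivial
    induction hn using Submodule.span_induction with
    | mem n hn =>
      obtain ⟨a, n, hn, rfl⟩ := hn
      -- The coefficient crosses the tensor sign, m ⊗ an = ma ⊗ n, and ma is expanded again in
      -- left-invariant elements.
      rw [← Bal.mk_balanced]
      exact h1 n hn _
    | zero => simp
    | add x y _ _ hx hy => rw [map_add]; exact add_mem hx hy
    | smul c x _ hx => rw [map_smul]; exact V.smul_mem c hx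
  rintro x -
  exact Bal.induction_on x h2 fun _ _ => V.add_mem

/-- Expand x in elements a(m ⊗ n) with m, n invariant and apply the projection: it fixes x and turns
each coefficient a into ε(a). -/
theorem Bal.mem_span_mk {δM : M →ₗ[ℂ] A ⊗[ℂ] M} (hM : IsLeftCovariant A δM)
    {δN : N →ₗ[ℂ] A ⊗[ℂ] N} (hN : IsLeftCovariant A δN) {x : Bal A M N}
    (hx : x ∈ leftInv (Bal.coact hM hN)) :
    x ∈ Submodule.span ℂ {x : Bal A M N | ∃ m ∈ leftInv δM, ∃ n ∈ leftInv δN,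
      x = Bal.mk A M N m n} := by
  rw [← invProj_eq_self hx]
  have hx' : x ∈ Submodule.span ℂ {x : Bal A M N | ∃ a : A, ∃ m ∈ leftInv δM, ∃ n ∈ leftInv δN,
      x = a • Bal.mk A M N m n} := by
    rw [Bal.span_smul_mk hM hN]; trivial
  clear hx
  induction hx' using Submodule.span_induction with
  | mem x hx =>
    obtain ⟨a, m, hm, n, hn, rfl⟩ := hx
    rw [invProj_smul (Bal.coact_smul hM hN) a (Bal.mk_mem_leftInv hM hN hm hn)]
    exact Submodule.smul_mem _ _ (Submodule.subset_span ⟨m, hm, n, hn, rfl⟩)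
  | zero => simp
  | add x y _ _ hx hy => rw [map_add]; exact add_mem hx hy
  | smul c x _ hx => rw [map_smul]; exact Submodule.smul_mem _ c hx

end Invariants

/-! ### Invariant one-forms and the formal adjoint of the differential -/

section Calculus

variable {A : Type*} [Ring A] [StarRing A] [HopfAlgebra ℂ A] [StarModule ℂ A]
variable {Γ : Type*} [AddCommGroup Γ] [Module ℂ Γ] [Module A Γ] [Module Aᵐᵒᵖ Γ]
  [SMulCommClass A Aᵐᵒᵖ Γ] [IsScalarTower ℂ A Γ] [IsScalarTower ℂ Aᵐᵒᵖ Γ]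
  [StarAddMonoid Γ] [StarModule ℂ Γ]

namespace StarCalculus

variable (K : StarCalculus A Γ)

theorem d_one : K.d 1 = 0 := by
  have h := K.leibniz 1 1
  simpa using h

theorem mcForm_eq (a : A) : mcForm K.d a = invProj K.coact (K.d a) := by
  rw [invProj, conv_apply, K.coact_d, mcForm, LinearMap.comp_apply]
  generalize comul (R := ℂ) a = t
  induction t with
  | zero => simp
  | add s t hs ht => simp only [map_add, hs, ht]
  | tmul a m => simp

theorem mcForm_mem (a : A) : mcForm K.d a ∈ leftInv K.coact := by
  rw [mcForm_eq]
  exact invProj_mem K.covariant.coassoc K.covariant.counit K.covariant.left _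

/-- da = a₍₁₎ω(a₍₂₎), from a₍₁₎S(a₍₂₎)da₍₃₎. Through this formula every computation with d reduces
to invariant forms. -/
theorem conv_mcForm : conv comul (lact A Γ) LinearMap.id (mcForm K.d) = K.d := by
  change conv comul (lact A Γ) LinearMap.id (conv comul (lact A Γ) (antipode ℂ) K.d) = K.d
  rw [← conv_comul_assoc (β := lact A Γ) (γ := LinearMap.mul ℂ A) (f := LinearMap.id)
    (k := antipode ℂ) (l := K.d), conv_antipode_right, conv_comul_unit_left]
  · simp
  · simp [mul_smul]

/-- One-forms are sums of a db = ab₍₁₎ω(b₍₂₎), which the projection sends to ε(ab₍₁₎)ω(b₍₂₎), a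
value of the linear map ω. -/
theorem exists_mcForm {θ : Γ} (hθ : θ ∈ leftInv K.coact) : ∃ a, θ = mcForm K.d a := by
  have h : ∀ γ, invProj K.coact γ ∈ LinearMap.range (mcForm K.d) := by
    intro γ
    have hγ : γ ∈ Submodule.span ℂ {γ | ∃ a b : A, γ = a • K.d b} := by
      rw [K.generates]; trivial
    induction hγ using Submodule.span_induction with
    | mem γ hγ =>
      obtain ⟨a, b, rfl⟩ := hγ
      have r := Coalgebra.Repr.arbitrary ℂ b
      have e := LinearMap.congr_fun K.conv_mcForm b
      rw [conv_comul_apply _ _ _ r] at e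
      rw [← e, Finset.smul_sum, map_sum]
      refine sum_mem fun i _ => ?_
      rw [lact_apply, smul_smul, invProj_smul K.covariant.left _ (K.mcForm_mem _)]
      exact Submodule.smul_mem _ _ ⟨_, rfl⟩
    | zero => simp
    | add x y _ _ hx hy => rw [map_add]; exact add_mem hx hy
    | smul c x _ hx => rw [map_smul]; exact Submodule.smul_mem _ c hx
  obtain ⟨a, ha⟩ := h θ
  exact ⟨a, by rw [ha, invProj_eq_self hθ]⟩

theorem star_mcForm
    (hstar : ∀ a : A, comul (R := ℂ) (star a) = star (comul (R := ℂ) a))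
    (b : A) : star (mcForm K.d b) = -mcForm K.d (star (antipode ℂ b)) := by
  have r := Coalgebra.Repr.arbitrary ℂ b
  have e1 : mcForm K.d b = ∑ i ∈ r.index, antipode ℂ (r.left i) • K.d (r.right i) :=
    conv_comul_apply (lact A Γ) (antipode ℂ) K.d r
  have e2 : mcForm K.d (star (antipode ℂ b)) =
      ∑ i ∈ r.index, star (r.right i) • K.d (star (antipode ℂ (r.left i))) := by
    refine (conv_comul_apply (lact A Γ) (antipode ℂ) K.d (starRepr hstar (antipodeRepr r))).trans ?_
    simp [starRepr, antipodeRepr, antipode_star_antipode hstar]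
  -- The differential of the starred antipode axiom: d(b₍₂₎^* S(b₍₁₎)^*) = 0. Of its two Leibniz
  -- terms, one is ω(b)^* and the other is ω(S(b)^*).
  have e3 := congrArg (fun x => K.d (star x)) (sum_antipode_mul_eq_smul r)
  simp only [star_sum, star_mul, map_sum, K.leibniz, StarModule.star_smul, star_one, map_smul, K.d_one,
    smul_zero, Finset.sum_add_distrib] at e3
  rw [e1, e2, ← sub_eq_zero, sub_neg_eq_add, ← e3, star_sum]
  simp [K.star_smul, K.star_d]

theorem star_mem_leftInv
    (hstar : ∀ a : A, comul (R := ℂ) (star a) = star (comul (R := ℂ) a))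
    {θ : Γ} (hθ : θ ∈ leftInv K.coact) : star θ ∈ leftInv K.coact := by
  obtain ⟨a, rfl⟩ := K.exists_mcForm hθ
  rw [K.star_mcForm hstar]
  exact neg_mem (K.mcForm_mem _)

/-- S reverses the coproduct, so S² preserves it; the twist of the calculus is compatible with d and
with the left action. -/
theorem sq_mcForm (a : A) : K.sq (mcForm K.d a) = mcForm K.d (antipodeSq A a) := by
  have r := Coalgebra.Repr.arbitrary ℂ a
  have e1 : mcForm K.d a = ∑ i ∈ r.index, antipode ℂ (r.left i) • K.d (r.right i) :=
    conv_comul_apply (lact A Γ) (antipode ℂ) K.d r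
  have e2 : mcForm K.d (antipodeSq A a) = ∑ i ∈ r.index,
      antipode ℂ (antipodeSq A (r.left i)) • K.d (antipodeSq A (r.right i)) :=
    conv_comul_apply (lact A Γ) (antipode ℂ) K.d (antipodeRepr (antipodeRepr r))
  rw [e1, e2, map_sum]
  simp [K.sq_smul, K.sq_d, antipodeSq]

/-- This combination of star, antipode and S² is the one that arises when the S²-symmetry of g is
used in the integration by parts. -/
theorem sq_star_mcForm
    (hstar : ∀ a : A, comul (R := ℂ) (star a) = star (comul (R := ℂ) a))
    (a : A) :
    K.sq (star (mcForm K.d (antipode ℂ (star a)))) = -mcForm K.d a := by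
  rw [K.star_mcForm hstar, map_neg, K.sq_mcForm, antipodeSq, LinearMap.comp_apply,
    antipode_star_antipode hstar, antipode_star_antipode hstar, star_star]

end StarCalculus

namespace SigmaMetric

variable {K : StarCalculus A Γ} {B : Braiding K} (G : SigmaMetric B)

/-- Since g is a comodule map, it sends invariant tensors to invariant elements of A, which are
scalars. -/
theorem g_leftInv {x : Bal A Γ Γ} (hx : x ∈ leftInv K.coact₂) :
    G.g x = counit (R := ℂ) (G.g x) • (1 : A) := by
  apply mem_leftInv_comul
  rw [mem_leftInv, G.covariant, mem_leftInv.1 hx]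
  simp

/-- The bilinear form `ε(g(θ ⊗ θ'))`. -/
def gForm : Γ →ₗ[ℂ] Γ →ₗ[ℂ] ℂ := (Bal.mk A Γ Γ).compr₂ (counit ∘ₗ G.g)

theorem g_mk {θ θ' : Γ} (hθ : θ ∈ leftInv K.coact) (hθ' : θ' ∈ leftInv K.coact) :
    G.g (Bal.mk A Γ Γ θ θ') = G.gForm θ θ' • (1 : A) :=
  G.g_leftInv (Bal.mk_mem_leftInv K.covariant K.covariant hθ hθ')

theorem g_d (a : A) {θ : Γ} (hθ : θ ∈ leftInv K.coact) {ι : Type*} (r : Coalgebra.Repr ℂ a ι) :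
    G.g (Bal.mk A Γ Γ (K.d a) θ) =
      ∑ i ∈ r.index, G.gForm (mcForm K.d (r.right i)) θ • r.left i := by
  have e := LinearMap.congr_fun K.conv_mcForm a
  rw [conv_comul_apply _ _ _ r] at e
  rw [← e, map_sum, LinearMap.sum_apply, map_sum]
  refine Finset.sum_congr rfl fun i _ => ?_
  rw [lact_apply, ← Bal.smul_mk, G.left, LinearMap.id_apply, G.g_mk (K.mcForm_mem _) hθ]
  simp

/-- The formal adjoint of the differential with respect to the Haar functional. -/
theorem haar_g_star_d (hstar : ∀ a : A, comul (R := ℂ) (star a) = star (comul (R := ℂ) a))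
    {h : A →ₗ[ℂ] ℂ} (hh : IsHaarFunctional A h) (a b : A) {θ : Γ} (hθ : θ ∈ leftInv K.coact) :
    h (a * G.g (Bal.mk A Γ Γ θ (star (K.d b)))) = -h (G.g (Bal.mk A Γ Γ (K.d a) θ) * star b) := by
  -- Z(x) = ε(g(θ ⊗ ω(x^*)^*)) is linear because it contains two conjugations. With it, g(θ ⊗
  -- (db)^*) = Z(b₍₂₎^*) b₍₁₎^*.
  let Z : A →ₗ[ℂ] ℂ :=
    { toFun := fun x => G.gForm θ (star (mcForm K.d (star x)))
      map_add' := by simp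
      map_smul' := by simp }
  have hZ : ∀ x, Z x = G.gForm θ (star (mcForm K.d (star x))) := fun _ => rfl
  -- Here the S²-symmetry of g enters, with the invariant form ω(S(x^*))^* as second argument. It
  -- produces the minus sign and exchanges the arguments of g.
  have hZT : ∀ x, Z (starAntipode A x) = -G.gForm (mcForm K.d x) θ := by
    intro x
    rw [hZ, starAntipode_apply, star_star]
    have h1 := G.sq_symm θ hθ _ (K.star_mem_leftInv hstar (K.mcForm_mem (antipode ℂ (star x))))
    rw [K.sq_star_mcForm hstar] at h1
    have h2 := congrArg (counit (R := ℂ)) h1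
    simpa [gForm] using h2.symm
  have r := Coalgebra.Repr.arbitrary ℂ b
  have s := Coalgebra.Repr.arbitrary ℂ a
  have e := LinearMap.congr_fun K.conv_mcForm b
  rw [conv_comul_apply _ _ _ r] at e
  have e1 : G.g (Bal.mk A Γ Γ θ (star (K.d b))) =
      ∑ i ∈ r.index, Z (star (r.right i)) • star (r.left i) := by
    rw [← e, star_sum, map_sum, map_sum]
    refine Finset.sum_congr rfl fun i _ => ?_
    rw [lact_apply, K.star_smul, ← Bal.op_smul_mk, G.right, LinearMap.id_apply,
      G.g_mk hθ (K.star_mem_leftInv hstar (K.mcForm_mem _)), hZ, star_star]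
    simp
  -- The Haar identity with c = b^*, evaluated by Z, is the claim once both sides are expanded.
  have e2 := congrArg Z (conv_haar hstar hh a (star b))
  rw [conv_comul_apply _ _ _ (starRepr hstar r), conv_comul_apply _ _ _ s] at e2
  rw [e1, G.g_d a hθ s]
  simp only [Finset.mul_sum, Finset.sum_mul, map_sum, mul_smul_comm, smul_mul_assoc, map_smul]
  simp only [starRepr, map_sum, LinearMap.lsmul_apply, map_smul, hZT,
    LinearMap.comp_apply, LinearMap.mulLeft_apply, LinearMap.mulRight_apply, LinearMap.id_apply,
    smul_eq_mul, mul_neg, Finset.sum_neg_distrib] at e2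
  simp only [smul_eq_mul, mul_comm (Z _), mul_comm (G.gForm _ _)]
  exact e2

end SigmaMetric

end Calculus

/-! ### Invariant spinors and the adjoint of the connection -/

section Spinors

variable {A : Type*} [Ring A] [StarRing A] [HopfAlgebra ℂ A] [StarModule ℂ A]
variable {Γ : Type*} [AddCommGroup Γ] [Module ℂ Γ] [Module A Γ] [Module Aᵐᵒᵖ Γ]
  [SMulCommClass A Aᵐᵒᵖ Γ] [IsScalarTower ℂ A Γ] [IsScalarTower ℂ Aᵐᵒᵖ Γ]
  [StarAddMonoid Γ] [StarModule ℂ Γ]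
variable {K : StarCalculus A Γ} {B : Braiding K} {G : SigmaMetric B} {S : SpinorModule G}

namespace SpinorModule

theorem formAct_mk (γ : Γ) (ψ : S.Space) :
    S.formAct (Bal.mk A Γ S.Space γ ψ) = Clifford.ofForm G γ • ψ := rfl

theorem formAct_smul (a : A) (x : Bal A Γ S.Space) : S.formAct (a • x) = a • S.formAct x := by
  induction x using Bal.induction_on with
  | mk γ ψ =>
    apply S.incl_injective
    rw [Bal.smul_mk, formAct_mk, formAct_mk, Clifford.ofForm_smul, incl_smul, incl_cl_smul,
      incl_cl_smul, mul_assoc, Clifford.smul_def]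
  | add x y hx hy => simp only [smul_add, map_add, hx, hy]

/-- The coaction of Cl is multiplicative, so (1 ⊗ θ)(1 ⊗ η) = 1 ⊗ θη there; injectivity of the
inclusion tensored with A brings this back to S. -/
theorem ofForm_smul_mem {θ : Γ} (hθ : θ ∈ leftInv K.coact) {η : S.Space}
    (hη : η ∈ leftInv S.coact) : Clifford.ofForm G θ • η ∈ leftInv S.coact := by
  rw [mem_leftInv]
  apply S.lTensor_incl_injective
  have h1 : Clifford.coact G (S.incl η) = 1 ⊗ₜ[ℂ] S.incl η := by
    rw [S.coact_incl, mem_leftInv.1 hη, LinearMap.lTensor_tmul]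
  have h2 : Clifford.coactHom G (Clifford.ofForm G θ) = 1 ⊗ₜ[ℂ] Clifford.ofForm G θ := by
    rw [Clifford.coactHom_ofForm, mem_leftInv.1 hθ, LinearMap.lTensor_tmul]
  rw [← S.coact_incl, incl_cl_smul]
  refine (map_mul (Clifford.coactHom G) _ _).trans ?_
  rw [h2]
  refine (congrArg (1 ⊗ₜ[ℂ] Clifford.ofForm G θ * ·) h1).trans ?_
  simp

theorem formAct_mem {x : Bal A Γ S.Space} (hx : x ∈ leftInv (Bal.coact K.covariant S.covariant)) :
    S.formAct x ∈ leftInv S.coact := by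
  have hx' := Bal.mem_span_mk K.covariant S.covariant hx
  clear hx
  induction hx' using Submodule.span_induction with
  | mem x hx =>
    obtain ⟨θ, hθ, η, hη, rfl⟩ := hx
    exact ofForm_smul_mem hθ hη
  | zero => simp
  | add x y _ _ hx hy => rw [map_add]; exact add_mem hx hy
  | smul c x _ hx => rw [map_smul]; exact Submodule.smul_mem _ c hx

end SpinorModule

theorem IsLeftCovariantConnection.map_mem {D : S.Space →ₗ[ℂ] Bal A Γ S.Space}
    (hD : IsLeftCovariantConnection S D) {η : S.Space} (hη : η ∈ leftInv S.coact) :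
    D η ∈ leftInv (Bal.coact K.covariant S.covariant) := by
  rw [mem_leftInv, hD, mem_leftInv.1 hη, LinearMap.lTensor_tmul]

namespace SpinorMetric

variable {h : A →ₗ[ℂ] ℂ} (m : SpinorMetric S h)

@[simp] theorem pair_mk (γ γ' : Γ) (ψ φ : S.Space) :
    m.pair (Bal.mk A Γ S.Space γ ψ) (Bal.mk A Γ S.Space γ' φ) =
      Bal.mk A Γ Γ γ (m.form ψ φ • star γ') := rfl

theorem pair_smul_smul (a b : A) (x y : Bal A Γ S.Space) :
    m.pair (a • x) (b • y) = a • op (star b) • m.pair x y := by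
  induction x using Bal.induction_on with
  | mk γ ψ =>
    induction y using Bal.induction_on with
    | mk γ' φ =>
      rw [Bal.smul_mk, Bal.smul_mk, pair_mk, pair_mk, K.star_smul, Bal.op_smul_mk, Bal.smul_mk,
        smul_comm]
    | add x y hx hy => simp only [smul_add, map_add, hx, hy]
  | add x y hx hy => simp only [smul_add, map_add, LinearMap.add_apply, hx, hy]

/-- The constant value of the metric on left-invariant spinors. -/
def invForm : S.Space →ₗ[ℂ] S.Space →ₛₗ[starRingEnd ℂ] ℂ :=
  LinearMap.mk₂'ₛₗ (RingHom.id ℂ) (starRingEnd ℂ) (fun ψ φ => counit (R := ℂ) (m.form ψ φ))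
    (by simp) (by simp) (by simp) (by simp)

theorem form_leftInv {η ζ : S.Space} (hη : η ∈ leftInv S.coact) (hζ : ζ ∈ leftInv S.coact) :
    m.form η ζ = m.invForm η ζ • (1 : A) := by
  apply mem_leftInv_comul
  rw [mem_leftInv, m.covariant, mem_leftInv.1 hη, mem_leftInv.1 hζ]
  simp

theorem ext_form {χ χ' : S.Space} (H : ∀ φ, h (m.form χ φ) = h (m.form χ' φ)) : χ = χ' := by
  rw [← sub_eq_zero]
  refine m.nondegenerate _ fun φ => ?_
  rw [map_sub, LinearMap.sub_apply, map_sub, H, sub_self]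

/-- ⟨η, aζ⟩₀ is the scalar value on (η, ζ) times a^*, and the elements aζ span S, so a vector
orthogonal to the invariants is orthogonal to everything. -/
theorem invForm_nondegenerate {η : S.Space} (hη : η ∈ leftInv S.coact)
    (H : ∀ ζ ∈ leftInv S.coact, m.invForm η ζ = 0) : η = 0 := by
  refine m.nondegenerate _ fun φ => ?_
  have hφ : φ ∈ Submodule.span ℂ {m : S.Space | ∃ a : A, ∃ n ∈ leftInv S.coact, m = a • n} := by
    rw [S.covariant.span_smul]; trivial
  induction hφ using Submodule.span_induction with
  | mem φ hφ =>
    obtain ⟨a, ζ, hζ, rfl⟩ := hφ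
    rw [m.smul_right, m.form_leftInv hη hζ, H ζ hζ]
    simp
  | zero => simp
  | add x y _ _ hx hy => rw [map_add, map_add, hx, hy, add_zero]
  | smul c x _ hx => simp [hx]

/-- Riesz representation in finite dimension: nondegeneracy makes the map from ξ to its values
against a basis injective, hence surjective by equality of dimensions. -/
theorem exists_invForm_eq [FiniteDimensional ℂ (leftInv S.coact)]
    (f : S.Space →ₛₗ[starRingEnd ℂ] ℂ) :
    ∃ ξ ∈ leftInv S.coact, ∀ ζ ∈ leftInv S.coact, m.invForm ξ ζ = f ζ := by
  let b := Module.finBasis ℂ (leftInv S.coact)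
  let F : leftInv S.coact →ₗ[ℂ] (Fin (Module.finrank ℂ (leftInv S.coact)) → ℂ) :=
    { toFun := fun ξ i => m.invForm ξ (b i)
      map_add' := fun x y => by ext i; simp
      map_smul' := fun c x => by ext i; simp }
  have hext : ∀ f f' : S.Space →ₛₗ[starRingEnd ℂ] ℂ, (∀ i, f (b i) = f' (b i)) →
      ∀ ζ ∈ leftInv S.coact, f ζ = f' ζ := by
    intro f f' H ζ hζ
    exact LinearMap.congr_fun (b.ext (f₁ := f.comp (leftInv S.coact).subtype)
      (f₂ := f'.comp (leftInv S.coact).subtype) H) ⟨ζ, hζ⟩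
  have hinj : Function.Injective F := by
    rw [injective_iff_map_eq_zero]
    intro ξ hξ
    exact Subtype.ext (m.invForm_nondegenerate ξ.2
      (hext _ 0 fun i => (congrFun hξ i).trans rfl))
  obtain ⟨ξ, hξ⟩ := (LinearMap.injective_iff_surjective_of_finrank_eq_finrank (by simp)).1 hinj
    (fun i => f (b i))
  exact ⟨ξ, ξ.2, hext _ _ fun i => congrFun hξ i⟩

theorem g_pair_leftInv
    (hstar : ∀ a : A, comul (R := ℂ) (star a) = star (comul (R := ℂ) a))
    {θ : Γ} (hθ : θ ∈ leftInv K.coact) {η : S.Space} (hη : η ∈ leftInv S.coact)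
    {y : Bal A Γ S.Space} (hy : y ∈ leftInv (Bal.coact K.covariant S.covariant)) :
    G.g (m.pair (Bal.mk A Γ S.Space θ η) y) =
      counit (R := ℂ) (G.g (m.pair (Bal.mk A Γ S.Space θ η) y)) • (1 : A) := by
  apply G.g_leftInv
  have hy' := Bal.mem_span_mk K.covariant S.covariant hy
  clear hy
  induction hy' using Submodule.span_induction with
  | mem y hy =>
    obtain ⟨θ', hθ', η', hη', rfl⟩ := hy
    rw [pair_mk, m.form_leftInv hη hη', smul_assoc, one_smul, map_smul]
    exact Submodule.smul_mem _ _
      (Bal.mk_mem_leftInv K.covariant K.covariant hθ (K.star_mem_leftInv hstar hθ'))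
  | zero => simp
  | add x y _ _ hx hy => rw [map_add]; exact add_mem hx hy
  | smul c x _ hx => rw [LinearMap.map_smulₛₗ]; exact Submodule.smul_mem _ _ hx

variable {D : S.Space →ₗ[ℂ] Bal A Γ S.Space}

/-- Test against φ = bζ and split ∇(bζ) = db ⊗ ζ + b∇ζ. Integration by parts moves d from b to a in
the first term; the second term is a scalar times ab^*, and that scalar is represented by a vector ξ
that depends on θ and η but not on a. -/
theorem exists_adjoint_smul_mk
    (hstar : ∀ a : A, comul (R := ℂ) (star a) = star (comul (R := ℂ) a))
    (hh : IsHaarFunctional A h) [FiniteDimensional ℂ (leftInv S.coact)]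
    (hD : IsLeftConnection K D) (hDcov : IsLeftCovariantConnection S D)
    {θ : Γ} (hθ : θ ∈ leftInv K.coact) {η : S.Space} (hη : η ∈ leftInv S.coact) :
    ∃ ξ ∈ leftInv S.coact, ∀ (a : A) (φ : S.Space),
      h (m.form (-(G.g (Bal.mk A Γ Γ (K.d a) θ) • η) + a • ξ) φ) =
        h (G.g (m.pair (a • Bal.mk A Γ S.Space θ η) (D φ))) := by
  -- ξ represents the conjugate linear functional ζ ↦ ε(g(⟨θ ⊗ η, ∇ζ⟩₀)).
  obtain ⟨ξ, hξ, hξ'⟩ := m.exists_invForm_eq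
    { toFun := fun ζ => counit (R := ℂ) (G.g (m.pair (Bal.mk A Γ S.Space θ η) (D ζ)))
      map_add' := by simp
      map_smul' := by simp }
  refine ⟨ξ, hξ, fun a φ => ?_⟩
  have hφ : φ ∈ Submodule.span ℂ {m : S.Space | ∃ a : A, ∃ n ∈ leftInv S.coact, m = a • n} := by
    rw [S.covariant.span_smul]; trivial
  induction hφ using Submodule.span_induction with
  | mem φ hφ =>
    obtain ⟨b, ζ, hζ, rfl⟩ := hφ
    have e1 := hξ' ζ hζ
    have e2 := m.g_pair_leftInv hstar hθ hη (hDcov.map_mem hζ)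
    simp only [LinearMap.coe_mk, AddHom.coe_mk] at e1
    rw [← e1] at e2
    have e3 := G.haar_g_star_d hstar hh a b hθ
    have e4 : G.g (m.pair (a • Bal.mk A Γ S.Space θ η) (Bal.mk A Γ S.Space (K.d b) ζ)) =
        m.invForm η ζ • (a * G.g (Bal.mk A Γ Γ θ (star (K.d b)))) := by
      rw [Bal.smul_mk, pair_mk, m.form_leftInv hη hζ, smul_assoc, one_smul, map_smul, map_smul,
        ← Bal.smul_mk, G.left]
    have e5 : G.g (m.pair (a • Bal.mk A Γ S.Space θ η) (b • D ζ)) =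
        m.invForm ξ ζ • (a * star b) := by
      rw [m.pair_smul_smul, G.left, G.right, e2, smul_mul_assoc, one_mul, mul_smul_comm]
    rw [hD, map_add (m.pair _), map_add G.g, map_add h, e4, e5, map_smul h, e3, m.smul_right,
      map_add m.form, LinearMap.add_apply, map_neg m.form, LinearMap.neg_apply, m.smul_left, m.smul_left,
      m.form_leftInv hη hζ, m.form_leftInv hξ hζ]
    simp [add_mul]
  | zero => simp
  | add x y _ _ hx hy =>
    simpa only [map_add, LinearMap.add_apply] using congrArg₂ (· + ·) hx hy
  | smul c x _ hx => simp only [map_smul, LinearMap.map_smulₛₗ, hx]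

/-- The adjoint of a left-covariant connection. -/
theorem exists_adjoint
    (hstar : ∀ a : A, comul (R := ℂ) (star a) = star (comul (R := ℂ) a))
    (hh : IsHaarFunctional A h) [FiniteDimensional ℂ (leftInv S.coact)]
    (hD : IsLeftConnection K D) (hDcov : IsLeftCovariantConnection S D) :
    ∃ T : Bal A Γ S.Space →ₗ[ℂ] S.Space,
      (∀ x φ, h (m.form (T x) φ) = h (G.g (m.pair x (D φ)))) ∧
      ∀ θ ∈ leftInv K.coact, ∀ η ∈ leftInv S.coact,
        T (Bal.mk A Γ S.Space θ η) ∈ leftInv S.coact ∧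
        ∀ a : A, T (a • Bal.mk A Γ S.Space θ η) =
          -(G.g (Bal.mk A Γ Γ (K.d a) θ) • η) + a • T (Bal.mk A Γ S.Space θ η) := by
  have hex : ∀ x, ∃ χ, ∀ φ, h (m.form χ φ) = h (G.g (m.pair x (D φ))) := by
    intro x
    have hx : x ∈ Submodule.span ℂ {x : Bal A Γ S.Space | ∃ a : A, ∃ m ∈ leftInv K.coact,
        ∃ n ∈ leftInv S.coact, x = a • Bal.mk A Γ S.Space m n} := by
      rw [Bal.span_smul_mk K.covariant S.covariant]; trivial
    induction hx using Submodule.span_induction with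
    | mem x hx =>
      obtain ⟨a, θ, hθ, η, hη, rfl⟩ := hx
      obtain ⟨ξ, -, hξ⟩ := m.exists_adjoint_smul_mk hstar hh hD hDcov hθ hη
      exact ⟨_, hξ a⟩
    | zero => exact ⟨0, by simp⟩
    | add x y _ _ hx hy =>
      obtain ⟨χ, hχ⟩ := hx
      obtain ⟨χ', hχ'⟩ := hy
      exact ⟨χ + χ', by simp [hχ, hχ']⟩
    | smul c x _ hx =>
      obtain ⟨χ, hχ⟩ := hx
      exact ⟨c • χ, by simp [hχ]⟩
  -- The value is determined by its pairings, so the chosen function is automatically linear.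
  choose T hT using hex
  refine ⟨⟨⟨T, fun x y => m.ext_form fun φ => ?_⟩, fun c x => m.ext_form fun φ => ?_⟩, hT,
    fun θ hθ η hη => ?_⟩
  · simp [hT]
  · simp [hT]
  · obtain ⟨ξ, hξ, hξ'⟩ := m.exists_adjoint_smul_mk hstar hh hD hDcov hθ hη
    have e : ∀ a, T (a • Bal.mk A Γ S.Space θ η) =
        -(G.g (Bal.mk A Γ Γ (K.d a) θ) • η) + a • ξ :=
      fun a => m.ext_form fun φ => by rw [hT, hξ']
    -- The case a = 1, where d1 = 0, identifies ξ as T(θ ⊗ η).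
    have e1 : T (Bal.mk A Γ S.Space θ η) = ξ := by
      have := e 1
      rw [one_smul] at this
      rw [this, K.d_one]
      simp
    exact ⟨(congrArg (· ∈ leftInv S.coact) e1).mpr hξ, fun a => (e a).trans (by rw [← e1]; rfl)⟩

end SpinorMetric

end Spinors

/-! ### Maps of first order and tangent functionals -/

section FirstOrder

variable {A : Type*} [Ring A] [HopfAlgebra ℂ A]
variable {Γ : Type*} [AddCommGroup Γ] [Module ℂ Γ] [Module A Γ] [IsScalarTower ℂ A Γ]
variable {M : Type*} [AddCommGroup M] [Module ℂ M] [Module A M] [IsScalarTower ℂ A M]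

/-- The maps `a ↦ a₍₁₎ u(a₍₂₎)`, where `u` has left-invariant values and vanishes on all `a` with
`ω(a) = 0` and `ε(a) = 0`. -/
def firstOrder (d : A →ₗ[ℂ] Γ) (δ : M →ₗ[ℂ] A ⊗[ℂ] M) : Submodule ℂ (A →ₗ[ℂ] M) where
  carrier := {T | ∃ u : A →ₗ[ℂ] M, (∀ a, u a ∈ leftInv δ) ∧
    (∀ a, mcForm d a = 0 → counit (R := ℂ) a = 0 → u a = 0) ∧
    T = conv comul (lact A M) LinearMap.id u}
  zero_mem' := ⟨0, by simp, by simp, by ext; simp [conv_comul_apply _ _ _ (Repr.arbitrary ℂ _)]⟩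
  add_mem' := by
    rintro _ _ ⟨u, hu, hu', rfl⟩ ⟨v, hv, hv', rfl⟩
    refine ⟨u + v, fun a => add_mem (hu a) (hv a), fun a h1 h2 => ?_, ?_⟩
    · rw [LinearMap.add_apply, hu' a h1 h2, hv' a h1 h2, add_zero]
    · ext
      simp [conv_comul_apply _ _ _ (Repr.arbitrary ℂ _), Finset.sum_add_distrib]
  smul_mem' := by
    rintro c _ ⟨u, hu, hu', rfl⟩
    refine ⟨c • u, fun a => Submodule.smul_mem _ c (hu a), fun a h1 h2 => ?_, ?_⟩
    · rw [LinearMap.smul_apply, hu' a h1 h2, smul_zero]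
    · ext
      simp [conv_comul_apply _ _ _ (Repr.arbitrary ℂ _), Finset.smul_sum, smul_comm c]

variable {d : A →ₗ[ℂ] Γ} {δ : M →ₗ[ℂ] A ⊗[ℂ] M}

theorem lact_flip_mem_firstOrder {η : M} (hη : η ∈ leftInv δ) :
    (lact A M).flip η ∈ firstOrder d δ := by
  -- The multiplication a ↦ aη has order zero: u(a) = ε(a)η.
  refine ⟨LinearMap.toSpanSingleton ℂ M η ∘ₗ counit, fun a => Submodule.smul_mem _ _ hη,
    fun a _ h => by simp [h], ?_⟩
  ext a
  have r := Repr.arbitrary ℂ a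
  have e : ∑ i ∈ r.index, counit (R := ℂ) (r.right i) • r.left i = a := by
    simpa only [map_sum, TensorProduct.rid_tmul, one_smul] using
      congrArg (TensorProduct.rid ℂ A) (sum_tmul_counit_eq r)
  rw [conv_comul_apply _ _ _ r, LinearMap.flip_apply, lact_apply]
  conv_lhs => rw [← e, Finset.sum_smul]
  refine Finset.sum_congr rfl fun i _ => ?_
  rw [smul_assoc]
  exact (smul_comm _ _ _).symm

/-- F need not be A-linear: vanishing on R_Γ comes from ω alone. Thus F may involve the adjoint or
the Dirac operator. -/
theorem conv_comp_mcForm_mem_firstOrder {F : Γ →ₗ[ℂ] M}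
    (hF : ∀ a, F (mcForm d a) ∈ leftInv δ) :
    conv comul (lact A M) LinearMap.id (F ∘ₗ mcForm d) ∈ firstOrder d δ :=
  ⟨F ∘ₗ mcForm d, hF, fun a h _ => by simp [h], rfl⟩

theorem toConv_mem_degreeLE_one {p : A →ₗ[ℂ] ℂ}
    (hp : ∀ a, mcForm d a = 0 → counit (R := ℂ) a = 0 → p a = 0) :
    WithConv.toConv p ∈ degreeLE d 1 := by
  rw [degreeLE, Submodule.pow_one]
  -- The decomposition p = p(1)ε + (p - p(1)ε), where ε is the convolution unit and the second
  -- summand also vanishes at 1, hence is tangent.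
  have e : WithConv.toConv p = p 1 • (1 : WithConv (A →ₗ[ℂ] ℂ)) +
      (WithConv.toConv p - p 1 • (1 : WithConv (A →ₗ[ℂ] ℂ))) := by abel
  rw [e]
  refine add_mem (Submodule.smul_mem _ _ (Submodule.mem_sup_left (Submodule.one_le.1 le_rfl)))
    (Submodule.mem_sup_right ⟨?_, fun a h1 h2 => ?_⟩)
  · simp
  · simp [hp a h1 h2, h2]

/-- In a basis of the left-invariant elements, a map of first order is given by functionals. -/
theorem exists_functionals_of_mem_firstOrder {n : ℕ} (b : Module.Basis (Fin n) ℂ (leftInv δ))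
    {T : A →ₗ[ℂ] M} (hT : T ∈ firstOrder d δ) :
    ∃ p : Fin n → WithConv (A →ₗ[ℂ] ℂ), (∀ j, p j ∈ degreeLE d 1) ∧
      ∀ a, T a = ∑ j, convRight (p j).ofConv a • (b j : M) := by
  obtain ⟨u, hu, hu', rfl⟩ := hT
  refine ⟨fun j => WithConv.toConv (b.coord j ∘ₗ u.codRestrict _ hu),
    fun j => toConv_mem_degreeLE_one fun a h1 h2 => ?_, fun a => ?_⟩
  · have : u.codRestrict _ hu a = 0 := Subtype.ext (hu' a h1 h2)
    rw [LinearMap.comp_apply, this, map_zero]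
  · have r := Repr.arbitrary ℂ a
    have e : ∀ x, u x = ∑ j, b.coord j (u.codRestrict _ hu x) • (b j : M) := by
      intro x
      have := congrArg Subtype.val (b.sum_repr (u.codRestrict _ hu x))
      rw [AddSubmonoidClass.coe_finsetSum] at this
      exact this.symm
    rw [conv_comul_apply _ _ _ r]
    simp only [LinearMap.id_apply, lact_apply, convRight, LinearMap.comp_apply, ← r.eq, map_sum,
      LinearMap.lTensor_tmul, LinearEquiv.coe_coe, TensorProduct.rid_tmul, Finset.sum_smul]
    rw [Finset.sum_comm]
    refine Finset.sum_congr rfl fun i _ => ?_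
    conv_lhs => rw [e, Finset.smul_sum]
    refine Finset.sum_congr rfl fun j _ => ?_
    rw [smul_assoc, smul_comm]

end FirstOrder

/-! ### Comparison of the Laplacian with the square of the Dirac operator -/

section Laplacian

variable {A : Type*} [Ring A] [StarRing A] [HopfAlgebra ℂ A] [StarModule ℂ A]
variable {Γ : Type*} [AddCommGroup Γ] [Module ℂ Γ] [Module A Γ] [Module Aᵐᵒᵖ Γ]
  [SMulCommClass A Aᵐᵒᵖ Γ] [IsScalarTower ℂ A Γ] [IsScalarTower ℂ Aᵐᵒᵖ Γ]
  [StarAddMonoid Γ] [StarModule ℂ Γ]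
variable {K : StarCalculus A Γ} {B : Braiding K} {G : SigmaMetric B} {S : SpinorModule G}

namespace SpinorModule

variable (S) in
/-- The map `ρ ⊗_A ρ' ↦ g(ρ ⊗_A ρ') η - ρ ρ' η`, the failure of the Clifford relation. -/
def cliffordDefect (η : S.Space) : Bal A Γ Γ →ₗ[ℂ] S.Space :=
  (lact A S.Space).flip η ∘ₗ G.g -
    S.cliffordAct ∘ₗ (Bal.mk A (Clifford G) S.Space).flip η ∘ₗ Clifford.ofForm₂ G

theorem cliffordDefect_apply (η : S.Space) (x : Bal A Γ Γ) :
    S.cliffordDefect η x = G.g x • η - Clifford.ofForm₂ G x • η := rfl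

theorem cliffordDefect_mk (η : S.Space) (γ γ' : Γ) :
    S.cliffordDefect η (Bal.mk A Γ Γ γ γ') =
      G.g (Bal.mk A Γ Γ γ γ') • η - Clifford.ofForm G γ • Clifford.ofForm G γ' • η := by
  have e : Clifford.ofForm₂ G (Bal.mk A Γ Γ γ γ') =
    Clifford.ofForm G γ * Clifford.ofForm G γ' := by simp [Clifford.ofForm₂, Clifford.ofForm]
  rw [cliffordDefect_apply, e, mul_smul]

theorem cliffordDefect_smul (η : S.Space) (a : A) (γ γ' : Γ) :
    S.cliffordDefect η (Bal.mk A Γ Γ (a • γ) γ') =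
      a • S.cliffordDefect η (Bal.mk A Γ Γ γ γ') := by
  rw [cliffordDefect_mk, cliffordDefect_mk, ← Bal.smul_mk, G.left, Clifford.ofForm_smul, smul_sub,
    mul_smul, mul_smul]
  rfl

theorem cliffordDefect_eq_zero (η : S.Space) {x : Bal A Γ Γ} (hx : B.σ x = x) :
    S.cliffordDefect η x = 0 := by
  rw [cliffordDefect_apply, Clifford.ofForm₂_eq G x (by simp [hx]), sub_eq_zero]
  rfl

theorem cliffordDefect_mem {η : S.Space} (hη : η ∈ leftInv S.coact) {θ θ' : Γ}
    (hθ : θ ∈ leftInv K.coact) (hθ' : θ' ∈ leftInv K.coact) :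
    S.cliffordDefect η (Bal.mk A Γ Γ θ θ') ∈ leftInv S.coact := by
  rw [cliffordDefect_mk, G.g_mk hθ hθ', smul_assoc, one_smul]
  exact sub_mem (Submodule.smul_mem _ _ hη) (ofForm_smul_mem hθ (ofForm_smul_mem hθ' hη))

/-- The second order parts of the Laplacian and of the square of the Dirac operator agree. -/
theorem conv_cliffordDefect_mem_firstOrder {η : S.Space} (hη : η ∈ leftInv S.coact) :
    conv comul ((Bal.mk A Γ Γ).compr₂ (S.cliffordDefect η)) K.d (mcForm K.d) ∈
      firstOrder K.d S.coact := by
  -- da₍₁₎ ⊗ ω(a₍₂₎) = a₍₁₎ω(a₍₂₎) ⊗ ω(a₍₃₎), and the defect is left A-linear, so u(a) is the defect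
  -- of ω(a₍₁₎) ⊗ ω(a₍₂₎).
  have e : conv comul ((Bal.mk A Γ Γ).compr₂ (S.cliffordDefect η)) K.d (mcForm K.d) =
      conv comul (lact A S.Space) LinearMap.id
        (conv comul ((Bal.mk A Γ Γ).compr₂ (S.cliffordDefect η)) (mcForm K.d) (mcForm K.d)) := by
    refine (congrArg (fun t => conv comul ((Bal.mk A Γ Γ).compr₂ (S.cliffordDefect η)) t
      (mcForm K.d)) K.conv_mcForm.symm).trans ?_
    exact conv_comul_assoc fun x y z => by simp [cliffordDefect_smul]
  refine ⟨_, fun a => ?_, fun a h1 h2 => ?_, e⟩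
  · rw [conv_comul_apply _ _ _ (Repr.arbitrary ℂ a)]
    exact sum_mem fun i _ => cliffordDefect_mem hη (K.mcForm_mem _) (K.mcForm_mem _)
  · have e1 : conv comul ((Bal.mk A Γ Γ).compr₂ (S.cliffordDefect η)) (mcForm K.d) (mcForm K.d) a =
        S.cliffordDefect η (mcForm₂ K (comul a)) := by
      rw [conv_comul_apply _ _ _ (Repr.arbitrary ℂ a), ← (Repr.arbitrary ℂ a).eq]
      simp [mcForm₂]
    rw [e1]
    -- The crux: for a in R_Γ the braiding fixes ω(a₍₁₎) ⊗ ω(a₍₂₎), so this tensor lies in ker(id -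
    -- σ), where the Clifford relation is imposed.
    exact cliffordDefect_eq_zero η (B.fixes a h1 h2)

end SpinorModule

variable {D : S.Space →ₗ[ℂ] Bal A Γ S.Space}

theorem diracOperator_smul (hD : IsLeftConnection K D) (a : A) (ψ : S.Space) :
    diracOperator S D (a • ψ) =
      Clifford.ofForm G (K.d a) • ψ + a • diracOperator S D ψ := by
  rw [diracOperator, LinearMap.comp_apply, hD, map_add, S.formAct_mk, S.formAct_smul]
  rfl

theorem diracOperator_mem (hDcov : IsLeftCovariantConnection S D) {η : S.Space}
    (hη : η ∈ leftInv S.coact) : diracOperator S D η ∈ leftInv S.coact :=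
  SpinorModule.formAct_mem (hDcov.map_mem hη)

/-- The map `ρ ↦ ρ η` from one-forms to spinors. -/
def SpinorModule.formOrbit (S : SpinorModule G) (η : S.Space) : Γ →ₗ[ℂ] S.Space :=
  S.formAct ∘ₗ (Bal.mk A Γ S.Space).flip η

theorem SpinorModule.formOrbit_apply (η : S.Space) (γ : Γ) :
    S.formOrbit η γ = Clifford.ofForm G γ • η := rfl

theorem SpinorModule.formOrbit_smul (η : S.Space) (a : A) (γ : Γ) :
    S.formOrbit η (a • γ) = a • S.formOrbit η γ :=
  (congrArg S.formAct (Bal.smul_mk a γ η)).symm.trans (S.formAct_smul a _)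

theorem SpinorModule.formOrbit_d_mem_firstOrder {η : S.Space} (hη : η ∈ leftInv S.coact) :
    S.formOrbit η ∘ₗ K.d ∈ firstOrder K.d S.coact := by
  have e : S.formOrbit η ∘ₗ K.d =
      conv comul (lact A S.Space) LinearMap.id (S.formOrbit η ∘ₗ mcForm K.d) := by
    ext a
    have r := Repr.arbitrary ℂ a
    have e := congrArg (S.formOrbit η) (LinearMap.congr_fun K.conv_mcForm a)
    rw [conv_comul_apply _ _ _ r, map_sum] at e
    rw [conv_comul_apply _ _ _ r, LinearMap.comp_apply, ← e]
    exact Finset.sum_congr rfl fun i _ => S.formOrbit_smul η _ _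
  rw [e]
  exact conv_comp_mcForm_mem_firstOrder fun a => S.ofForm_smul_mem (K.mcForm_mem a) hη

theorem g_d_smul_mem_firstOrder {θ : Γ} (hθ : θ ∈ leftInv K.coact) {η : S.Space}
    (hη : η ∈ leftInv S.coact) :
    (lact A S.Space).flip η ∘ₗ G.g ∘ₗ (Bal.mk A Γ Γ).flip θ ∘ₗ K.d ∈ firstOrder K.d S.coact := by
  have e : (lact A S.Space).flip η ∘ₗ G.g ∘ₗ (Bal.mk A Γ Γ).flip θ ∘ₗ K.d =
      conv comul (lact A S.Space) LinearMap.id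
        ((LinearMap.toSpanSingleton ℂ S.Space η ∘ₗ G.gForm.flip θ) ∘ₗ mcForm K.d) := by
    ext a
    have r := Repr.arbitrary ℂ a
    rw [conv_comul_apply _ _ _ r]
    simp only [LinearMap.comp_apply, LinearMap.flip_apply, lact_apply, G.g_d a hθ r,
      Finset.sum_smul, LinearMap.id_apply, LinearMap.toSpanSingleton_apply]
    refine Finset.sum_congr rfl fun i _ => ?_
    rw [smul_assoc, smul_comm]
  rw [e]
  exact conv_comp_mcForm_mem_firstOrder fun a => Submodule.smul_mem _ _ hη

/-- If `T` has the form of the adjoint of a connection, then `-T D - (Dirac)²` is of first order. -/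
theorem adjoint_comp_sub_dirac_sq_mem_firstOrder (hD : IsLeftConnection K D)
    (hDcov : IsLeftCovariantConnection S D) {T : Bal A Γ S.Space →ₗ[ℂ] S.Space}
    (hT : ∀ θ ∈ leftInv K.coact, ∀ η ∈ leftInv S.coact,
        T (Bal.mk A Γ S.Space θ η) ∈ leftInv S.coact ∧
        ∀ a : A, T (a • Bal.mk A Γ S.Space θ η) =
          -(G.g (Bal.mk A Γ Γ (K.d a) θ) • η) + a • T (Bal.mk A Γ S.Space θ η))
    {η : S.Space} (hη : η ∈ leftInv S.coact) :
    (-(T ∘ₗ D) - diracOperator S D ∘ₗ diracOperator S D) ∘ₗ (lact A S.Space).flip η ∈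
      firstOrder K.d S.coact := by
  -- Covers the term T(a∇η): since ∇η is an invariant tensor, it suffices to treat y = θ ⊗ ζ, where
  -- the formula for T gives a term with da and a term of order zero.
  have h1 : ∀ y ∈ leftInv (Bal.coact K.covariant S.covariant),
      T ∘ₗ (lact A _).flip y ∈ firstOrder K.d S.coact := by
    intro y hy
    have hy' := Bal.mem_span_mk K.covariant S.covariant hy
    clear hy
    induction hy' using Submodule.span_induction with
    | mem y hy =>
      obtain ⟨θ, hθ, ζ, hζ, rfl⟩ := hy
      have e : T ∘ₗ (lact A _).flip (Bal.mk A Γ S.Space θ ζ) =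
          -((lact A S.Space).flip ζ ∘ₗ G.g ∘ₗ (Bal.mk A Γ Γ).flip θ ∘ₗ K.d) +
            (lact A S.Space).flip (T (Bal.mk A Γ S.Space θ ζ)) :=
        LinearMap.ext fun a => (hT θ hθ ζ hζ).2 a
      rw [e]
      exact add_mem (neg_mem (g_d_smul_mem_firstOrder hθ hζ))
        (lact_flip_mem_firstOrder (hT θ hθ ζ hζ).1)
    | zero => simp
    | add x y _ _ hx hy => rw [map_add, LinearMap.comp_add]; exact add_mem hx hy
    | smul c x _ hx => rw [map_smul, LinearMap.comp_smul]; exact Submodule.smul_mem _ c hx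
  have h2 := conv_comp_mcForm_mem_firstOrder (d := K.d) (δ := S.coact)
    (F := T ∘ₗ (Bal.mk A Γ S.Space).flip η) fun a => (hT _ (K.mcForm_mem a) η hη).1
  have h3 := conv_comp_mcForm_mem_firstOrder (d := K.d) (δ := S.coact)
    (F := diracOperator S D ∘ₗ S.formOrbit η)
    fun a => diracOperator_mem hDcov (S.ofForm_smul_mem (K.mcForm_mem a) hη)
  have hη' := diracOperator_mem hDcov hη
  have h4 := S.formOrbit_d_mem_firstOrder hη'
  have h5 := lact_flip_mem_firstOrder (d := K.d) (diracOperator_mem hDcov hη')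
  have h6 := SpinorModule.conv_cliffordDefect_mem_firstOrder hη
  -- Leibniz is used twice on each side. The terms g(da₍₁₎ ⊗ ω(a₍₂₎))η and da₍₁₎ω(a₍₂₎)η combine
  -- into the Clifford defect. Left over are a₍₁₎T(ω(a₍₂₎) ⊗ η) and T(a∇η) from the Laplacian, and
  -- the three lower terms of the squared Dirac operator.
  have e : (-(T ∘ₗ D) - diracOperator S D ∘ₗ diracOperator S D) ∘ₗ (lact A S.Space).flip η =
      conv comul ((Bal.mk A Γ Γ).compr₂ (S.cliffordDefect η)) K.d (mcForm K.d) -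
      conv comul (lact A S.Space) LinearMap.id
        ((T ∘ₗ (Bal.mk A Γ S.Space).flip η) ∘ₗ mcForm K.d) -
      T ∘ₗ (lact A _).flip (D η) -
      conv comul (lact A S.Space) LinearMap.id
        ((diracOperator S D ∘ₗ S.formOrbit η) ∘ₗ mcForm K.d) -
      S.formOrbit (diracOperator S D η) ∘ₗ K.d -
      (lact A S.Space).flip (diracOperator S D (diracOperator S D η)) := by
    ext a
    have r := Repr.arbitrary ℂ a
    have ed : K.d a = ∑ i ∈ r.index, r.left i • mcForm K.d (r.right i) := by
      have := LinearMap.congr_fun K.conv_mcForm a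
      rw [conv_comul_apply _ _ _ r] at this
      exact this.symm
    have e1 : T (Bal.mk A Γ S.Space (K.d a) η) = ∑ i ∈ r.index,
        (-(G.g (Bal.mk A Γ Γ (K.d (r.left i)) (mcForm K.d (r.right i))) • η) +
          r.left i • T (Bal.mk A Γ S.Space (mcForm K.d (r.right i)) η)) := by
      conv_lhs => rw [ed, map_sum, LinearMap.sum_apply, map_sum]
      exact Finset.sum_congr rfl fun i _ => (hT _ (K.mcForm_mem _) η hη).2 _
    have e2 : diracOperator S D (Clifford.ofForm G (K.d a) • η) = ∑ i ∈ r.index,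
        (Clifford.ofForm G (K.d (r.left i)) • Clifford.ofForm G (mcForm K.d (r.right i)) • η +
          r.left i • diracOperator S D (Clifford.ofForm G (mcForm K.d (r.right i)) • η)) := by
      rw [← S.formOrbit_apply]
      conv_lhs => rw [ed, map_sum, map_sum]
      refine Finset.sum_congr rfl fun i _ => ?_
      rw [S.formOrbit_smul, diracOperator_smul hD, S.formOrbit_apply]
    simp only [LinearMap.sub_apply, LinearMap.neg_apply, LinearMap.comp_apply,
      LinearMap.flip_apply, lact_apply, conv_comul_apply _ _ _ r, LinearMap.id_apply,
      LinearMap.compr₂_apply, S.cliffordDefect_mk, S.formOrbit_apply]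
    rw [diracOperator_smul hD, map_add, e2, diracOperator_smul hD, hD, map_add, e1]
    simp only [Finset.sum_add_distrib, Finset.sum_sub_distrib, Finset.sum_neg_distrib]
    abel
  rw [e]
  exact sub_mem (sub_mem (sub_mem (sub_mem (sub_mem h6 h2) (h1 _ (hDcov.map_mem hη))) h3) h4) h5

theorem isLeftInvariantDiffOp_one [FiniteDimensional ℂ (leftInv S.coact)]
    {T : S.Space →ₗ[ℂ] S.Space}
    (hT : ∀ η ∈ leftInv S.coact, T ∘ₗ (lact A S.Space).flip η ∈ firstOrder K.d S.coact) :
    IsLeftInvariantDiffOp S 1 T := by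
  let b := Module.finBasis ℂ (leftInv S.coact)
  choose p hp hp' using fun i => exists_functionals_of_mem_firstOrder b (hT (b i) (b i).2)
  exact ⟨_, b, fun j i => p i j, fun j i => hp i j, fun a i => hp' i a⟩

end Laplacian

end QuantumSpin

end

theorem mainTheorem11
    {A : Type*} [Ring A] [StarRing A] [HopfAlgebra ℂ A] [StarModule ℂ A]
    (hstar : ∀ a : A, Coalgebra.comul (R := ℂ) (star a) = star (Coalgebra.comul (R := ℂ) a))
    (hcos : QuantumSpin.IsCosemisimple A)
    (h : A →ₗ[ℂ] ℂ) (hh : QuantumSpin.IsHaarFunctional A h)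
    {Γ : Type*} [AddCommGroup Γ] [Module ℂ Γ] [Module A Γ] [Module Aᵐᵒᵖ Γ]
    [SMulCommClass A Aᵐᵒᵖ Γ] [IsScalarTower ℂ A Γ] [IsScalarTower ℂ Aᵐᵒᵖ Γ]
    [StarAddMonoid Γ] [StarModule ℂ Γ]
    (K : QuantumSpin.StarCalculus A Γ)
    (B : QuantumSpin.Braiding K)
    (G : QuantumSpin.SigmaMetric B)
    (S : QuantumSpin.SpinorModule G)
    [FiniteDimensional ℂ (QuantumSpin.leftInv S.coact)]
    (m : QuantumSpin.SpinorMetric S h)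
    (D : S.Space →ₗ[ℂ] QuantumSpin.Bal A Γ S.Space)
    (hD : QuantumSpin.IsLinearLeftConnection S D)
    (hDcov : QuantumSpin.IsLeftCovariantConnection S D)
    (hker : LinearMap.ker (LinearMap.id - B.σ.toLinearMap) =
      LinearMap.ker ((LinearMap.id - B.σ.toLinearMap) ∘ₗ (LinearMap.id - B.σ.toLinearMap))) :
    (∃! L : S.Space →ₗ[ℂ] S.Space, QuantumSpin.IsConnectionLaplacian m D L) ∧
    ∀ L : S.Space →ₗ[ℂ] S.Space, QuantumSpin.IsConnectionLaplacian m D L →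
      QuantumSpin.IsLeftInvariantDiffOp S 1
        (L - QuantumSpin.diracOperator S D ∘ₗ QuantumSpin.diracOperator S D) := by

  -- T is the adjoint of ∇, so -T∇ satisfies the equation of the Laplacian, and nondegeneracy of the
  -- metric forces every solution to equal it.
  obtain ⟨T, hT, hT'⟩ := m.exists_adjoint hstar hh hD.connection hDcov
  have hL : QuantumSpin.IsConnectionLaplacian m D (-(T ∘ₗ D)) := by
    intro ψ φ
    rw [LinearMap.neg_apply, map_neg, LinearMap.neg_apply, map_neg, LinearMap.comp_apply, hT]
  have huniq : ∀ L, QuantumSpin.IsConnectionLaplacian m D L → L = -(T ∘ₗ D) := fun L h' =>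
    LinearMap.ext fun ψ => m.ext_form fun φ => (h' ψ φ).trans (hL ψ φ).symm
  refine ⟨⟨_, hL, huniq⟩, fun L h' => ?_⟩
  rw [huniq L h']
  exact QuantumSpin.isLeftInvariantDiffOp_one fun η hη =>
    QuantumSpin.adjoint_comp_sub_dirac_sq_mem_firstOrder hD.connection hDcov hT' hη
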